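/- Let $\varepsilon>0$. There is $p_0=p_0(\varepsilon)$ such that the following holds for every prime $p\ge p_0$. Let $\mathcal I$ and $\mathcal J$ be intervals of $\mathbb F_p$ (an interval is the set of residue classes modulo $p$ of a finite set of consecutive integers) with $$|\mathcal I|^2\cdot|\mathcal J|>p^{1+\varepsilon},\qquad |\mathcal I|\cdot|\mathcal J|^2>p^{1+\varepsilon}.$$ Then for every $\lambda\in\mathbb F_p$ the equation $$\sum_{i=1}^{8}\frac{x_i}{y_i}=\lambda$$ has a solution with $x_1,\dots,x_8\in\mathcal I$ and $y_1,\dots,y_8\in\mathcal J\setminus\{0\}$. In particular, for every $\varepsilon>0$ there are $\delta=\delta(\varepsilon)>0$ and $p_0'=p_0'(\varepsilon)$ such that, for every prime $p\ge p_0'$ and all intervals $\mathcal I,\mathcal J$ of $\mathbb F_p$ with $|\mathcal I|>p^{1/3+\varepsilon}$ and $|\mathcal J|>p^{1/3-\delta}$, every $\lambda\in\mathbb F_p$ can be represented in the same form. -/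

import Mathlib

/-- An interval of `ZMod p`: the set of residue classes of the integers `m, m + 1, …, n`.
It may have any position, wrap around zero, or be all of `ZMod p`. -/
def IsIntervalMod (p : ℕ) (I : Finset (ZMod p)) : Prop :=
  ∃ m n : ℤ, I = (Finset.Icc m n).image (fun k : ℤ => (k : ZMod p))

/-- `lam` is a sum of `n` fractions `x i / y i` with numerators in `I` and nonzero
denominators in `J`. -/
def IsSumOfFractions (p : ℕ) [Fact p.Prime] (n : ℕ) (I J : Finset (ZMod p))
    (lam : ZMod p) : Prop :=
  ∃ x y : Fin n → ZMod p, (∀ i, x i ∈ I) ∧ (∀ i, y i ∈ J ∧ y i ≠ 0) ∧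
    ∑ i, x i / y i = lam

/-! Half of the fractions suffice to fill more than half of `ZMod p`, and a set that large added to
itself is everything. Take numerators in an interval of length N = 2H, denominators y + j with j <
M, and fix j₁, j₂, x. By Parseval and Cauchy–Schwarz the sums n₁/(y+j₁) + n₂/(y+j₂) + x(1/(y+t₁) +
1/(y+t₂)) take more than p/2 values as soon as ∑_{a≠0} d(a/(y+j₁)) d(a/(y+j₂)) k(ax) < N⁴M⁴, where d
is the squared Dirichlet kernel of length N and k the squared exponential sum over pairs of
reciprocals.

It is enough to have this on average over j₁, j₂ and over x = x₀ + q₁ - q₂ with q₁, q₂ < H. The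
average is governed by ∑_{a≠0} F(a)²W(a), with F(a) = ∑_j d(a/(y+j)) and W(a) = ∑_q k(ax). Three
facts control it (`sum_kernel_le`). The deviation of F from its typical size NM has small mean
square, by a count of solutions of u₁/(y+j₁) = u₂/(y+j₂) (`card_ratio_energy_le`). The sum ∑ k is p
times the additive energy of the reciprocals, which reduces to points on a modular hyperbola in a
short box (`card_hyperbola_le`). Finally, k is positive definite, so W is at most its analogue
centred at x₀ = 0; dilations by small u then pass from k to d, and the mean of d(a/u) is small
(`exists_sum_norm_expSum_div_le`).

Each count lifts a congruence to few integer equations and ends with a divisor bound D = p^{o(1)},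
which the factor p^ε absorbs. -/

section FractionSums

open Finset

/-! ### Divisor bounds and elementary counting. -/

/-- The divisor bound: `τ(n) ≪ n ^ η` for every `η > 0`. -/
lemma exists_card_divisors_le_mul_rpow {η : ℝ} (hη : 0 < η) :
    ∃ C : ℝ, 0 < C ∧ ∀ n : ℕ, n ≠ 0 → (#n.divisors : ℝ) ≤ C * (n : ℝ) ^ η := by
  have hl2 : 0 < Real.log 2 := Real.log_pos (by norm_num)
  -- `A` is chosen so that v + 1 ≤ A(1 + ηv log 2) ≤ A·2^{ηv}. A prime q ≥ `P` has q^η ≥ 2 and needs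
  -- no constant, so `A` is paid at most `P` times.
  set A : ℝ := 1 + 1 / (η * Real.log 2) with hA
  have hA1 : 1 ≤ A := by rw [hA]; have : 0 < 1 / (η * Real.log 2) := by positivity
                         linarith
  set P : ℕ := ⌈(2 : ℝ) ^ (1 / η)⌉₊ with hP
  refine ⟨A ^ P, by positivity, fun n hn => ?_⟩
  have key : ∀ q ∈ n.primeFactors, ((n.factorization q + 1 : ℕ) : ℝ) ≤
      (if q < P then A else 1) * ((q : ℝ) ^ n.factorization q) ^ η := by
    intro q hq
    have hqp := Nat.prime_of_mem_primeFactors hq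
    set v := n.factorization q
    have hq2 : (2 : ℝ) ≤ q := by exact_mod_cast hqp.two_le
    split_ifs with h
    · have h1 : ((2 : ℝ) ^ v) ^ η ≤ ((q : ℝ) ^ v) ^ η := by gcongr
      have h2 : 1 + η * Real.log 2 * v ≤ ((2 : ℝ) ^ v) ^ η := by
        have : ((2 : ℝ) ^ v) ^ η = Real.exp (η * Real.log 2 * v) := by
          rw [Real.rpow_def_of_pos (by positivity), Real.log_pow]; ring_nf
        rw [this]
        have := Real.add_one_le_exp (η * Real.log 2 * v)
        linarith
      have h3 : ((v + 1 : ℕ) : ℝ) ≤ A * (1 + η * Real.log 2 * v) := by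
        have : A * (1 + η * Real.log 2 * v) = 1 + η * Real.log 2 * v + 1 / (η * Real.log 2) + v := by
          rw [hA]; field_simp; ring
        rw [this]; push_cast
        have : 0 ≤ η * Real.log 2 * v := by positivity
        have : 0 ≤ 1 / (η * Real.log 2) := by positivity
        linarith
      calc _ ≤ A * (1 + η * Real.log 2 * v) := h3
        _ ≤ _ := by gcongr; exact h2.trans h1
    · rw [one_mul]
      have hPq : (2 : ℝ) ^ (1 / η) ≤ q := (Nat.le_ceil _).trans (by exact_mod_cast not_lt.mp h)
      have h1 : (2 : ℝ) ≤ (q : ℝ) ^ η := by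
        calc (2 : ℝ) = ((2 : ℝ) ^ (1 / η)) ^ η := by
              rw [← Real.rpow_mul (by norm_num), one_div, inv_mul_cancel₀ hη.ne', Real.rpow_one]
          _ ≤ _ := by gcongr
      calc ((v + 1 : ℕ) : ℝ) ≤ (2 : ℝ) ^ v := by exact_mod_cast Nat.lt_two_pow_self
        _ ≤ ((q : ℝ) ^ η) ^ v := by gcongr
        _ = ((q : ℝ) ^ v) ^ η := by
            rw [← Real.rpow_natCast, ← Real.rpow_natCast, ← Real.rpow_mul (by positivity),
              ← Real.rpow_mul (by positivity), mul_comm]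
  rw [Nat.card_divisors hn, Nat.cast_prod]
  calc ∏ q ∈ n.primeFactors, ((n.factorization q + 1 : ℕ) : ℝ)
      ≤ ∏ q ∈ n.primeFactors, ((if q < P then A else 1) * ((q : ℝ) ^ n.factorization q) ^ η) :=
        prod_le_prod (fun _ _ => by positivity) key
    _ = (∏ q ∈ n.primeFactors, if q < P then A else 1) * (n : ℝ) ^ η := by
        rw [prod_mul_distrib, Real.finsetProd_rpow _ _ (fun _ _ => by positivity)]
        congr 2
        have := Nat.prod_factorization_pow_eq_self hn
        conv_rhs => rw [← this]
        simp [Finsupp.prod]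
    _ ≤ A ^ P * (n : ℝ) ^ η := by
        gcongr
        rw [prod_ite, prod_const, prod_const_one, mul_one]
        apply pow_le_pow_right₀ hA1
        calc _ ≤ #(range P) := card_le_card (by intro q; simp)
          _ = P := card_range P

/-- The range p⁶ is a crude bound for every integer factored below. Exponent η/12 on it costs
p^{η/2}, and the remaining p^{η/2} absorbs the constant for large p. -/
lemma exists_divisor_bound {η : ℝ} (hη : 0 < η) :
    ∃ p₀ : ℕ, ∀ p : ℕ, p₀ ≤ p → ∃ D : ℕ, 1 ≤ D ∧ (D : ℝ) ≤ (p : ℝ) ^ η ∧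
      ∀ n : ℕ, n ≠ 0 → n ≤ p ^ 6 → #n.divisors ≤ D := by
  obtain ⟨C, hC, h⟩ := exists_card_divisors_le_mul_rpow (η := η / 12) (by positivity)
  have ht : Filter.Tendsto (fun p : ℕ => (p : ℝ) ^ (η / 2)) Filter.atTop Filter.atTop :=
    (tendsto_rpow_atTop (by positivity)).comp tendsto_natCast_atTop_atTop
  obtain ⟨p₀, hp₀⟩ := Filter.eventually_atTop.1 (ht.eventually_ge_atTop (C + 1))
  refine ⟨max p₀ 1, fun p hp => ?_⟩
  have hp1 : (1 : ℝ) ≤ p := by exact_mod_cast (le_max_right _ _).trans hp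
  have h1 := hp₀ p ((le_max_left _ _).trans hp)
  have h2 : 1 ≤ (p : ℝ) ^ η := Real.one_le_rpow hp1 hη.le
  refine ⟨⌊(p : ℝ) ^ η⌋₊, Nat.le_floor (by simpa using h2), Nat.floor_le (by positivity), ?_⟩
  intro n hn hnp
  apply Nat.le_floor
  calc (#n.divisors : ℝ) ≤ C * (n : ℝ) ^ (η / 12) := h n hn
    _ ≤ C * ((p : ℝ) ^ 6) ^ (η / 12) := by gcongr; exact_mod_cast hnp
    _ = C * (p : ℝ) ^ (η / 2) := by
        rw [← Real.rpow_natCast, ← Real.rpow_mul (by positivity)]; congr 2; push_cast; ring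
    _ ≤ (p : ℝ) ^ (η / 2) * (p : ℝ) ^ (η / 2) := by gcongr; linarith
    _ = (p : ℝ) ^ η := by rw [← Real.rpow_add (by positivity)]; congr 1; ring

/-- A set of integer divisors of `m ≠ 0` has at most `2 τ(|m|)` elements. -/
lemma card_le_two_mul_card_divisors {A : Finset ℤ} {m : ℤ} (hm : m ≠ 0) (hA : ∀ x ∈ A, x ∣ m) :
    #A ≤ 2 * #m.natAbs.divisors := by
  have hsub : A ⊆ m.natAbs.divisors.image (fun d : ℕ => (d : ℤ)) ∪
      m.natAbs.divisors.image (fun d : ℕ => -(d : ℤ)) := by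
    intro x hx
    have hd : x.natAbs ∈ m.natAbs.divisors := by
      simp [Nat.mem_divisors, hm, Int.natAbs_dvd_natAbs, hA x hx]
    rcases Int.natAbs_eq x with h | h
    · exact mem_union_left _ (mem_image.2 ⟨_, hd, h.symm⟩)
    · exact mem_union_right _ (mem_image.2 ⟨_, hd, h.symm⟩)
  calc #A ≤ _ := card_le_card hsub
    _ ≤ _ := card_union_le _ _
    _ ≤ #m.natAbs.divisors + #m.natAbs.divisors := add_le_add card_image_le card_image_le
    _ = _ := by ring

/-- A set of integers in `[-X, X]` lying in one residue class modulo `p` has at most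
`2X/p + 1` elements. -/
lemma card_le_of_forall_cast_eq {p : ℕ} (hp : 0 < p) {X : ℝ} (hX : 0 ≤ X) {A : Finset ℤ} (c : ZMod p)
    (hA : ∀ x ∈ A, |(x : ℝ)| ≤ X ∧ (x : ZMod p) = c) : (#A : ℝ) ≤ 2 * X / p + 1 := by
  rcases A.eq_empty_or_nonempty with rfl | hne
  · simp only [card_empty, Nat.cast_zero]; positivity
  have hpr : (0 : ℝ) < p := by exact_mod_cast hp
  set x₀ := A.min' hne
  have hx₀ : x₀ ∈ A := A.min'_mem hne
  have hdiv : ∀ x ∈ A, ∃ q : ℕ, x = x₀ + p * q ∧ (q : ℝ) ≤ 2 * X / p := by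
    intro x hx
    have h1 : ((x - x₀ : ℤ) : ZMod p) = 0 := by
      push_cast; rw [(hA x hx).2, (hA x₀ hx₀).2, sub_self]
    obtain ⟨q, hq⟩ := (ZMod.intCast_zmod_eq_zero_iff_dvd _ p).1 h1
    have h0 : 0 ≤ x - x₀ := sub_nonneg.2 (A.min'_le x hx)
    have hq0 : 0 ≤ q := by
      by_contra hneg
      have : (p : ℤ) * q < 0 := mul_neg_of_pos_of_neg (by exact_mod_cast hp) (not_le.1 hneg)
      omega
    lift q to ℕ using hq0
    refine ⟨q, by linarith, ?_⟩
    rw [le_div_iff₀ hpr]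
    have h2 : (x : ℝ) - x₀ = p * q := by exact_mod_cast hq
    have h3 := abs_le.1 (hA x hx).1
    have h4 := abs_le.1 (hA x₀ hx₀).1
    linarith
  have hsub : A ⊆ (range (⌊2 * X / p⌋₊ + 1)).image (fun q : ℕ => x₀ + p * (q : ℤ)) := by
    intro x hx
    obtain ⟨q, h1, h2⟩ := hdiv x hx
    exact mem_image.2 ⟨q, mem_range.2 (Nat.lt_succ_of_le (Nat.le_floor h2)), h1.symm⟩
  calc (#A : ℝ) ≤ ((⌊2 * X / p⌋₊ + 1 : ℕ) : ℝ) := by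
        exact_mod_cast (card_le_card hsub).trans (card_image_le.trans (card_range _).le)
    _ ≤ _ := by push_cast; gcongr; exact Nat.floor_le (by positivity)

/-! ### Points on modular hyperbolas and energy estimates. -/

/-- Concentration of points on the modular hyperbola `(z + s) (z + t) = κ`. -/
lemma card_hyperbola_le {p : ℕ} [Fact p.Prime] {D M T : ℕ}
    (hD : ∀ n : ℕ, n ≠ 0 → n ≤ p ^ 6 → #n.divisors ≤ D) (hM : M ≤ p) (hT : 1 ≤ T) (hTp : T < p)
    (z κ : ZMod p) (hκ : κ ≠ 0) :
    (#{t ∈ range M ×ˢ range M | (z + (t.1 : ℕ)) * (z + (t.2 : ℕ)) = κ} : ℝ) ≤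
      2 * D * (2 * (T * M ^ 2 + 2 * M * (p / T)) / p + 1) := by
  have hp0 : 0 < p := (Fact.out : p.Prime).pos
  have hpr : (0 : ℝ) < p := by exact_mod_cast hp0
  have hTr : (0 : ℝ) < T := by exact_mod_cast hT
  -- Dirichlet approximation: some 0 < k ≤ T makes kz congruent to a small `r`. Multiplied by k, the
  -- equation fixes k t₁t₂ + r(t₁+t₂) modulo p, an integer small enough to have few possible values.
  obtain ⟨j, k, hk0, hkT, hkj⟩ := Real.exists_int_int_abs_mul_sub_le ((z.val : ℝ) / p) hT
  set r : ℤ := k * z.val - j * p with hr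
  have hrz : (r : ZMod p) = k * z := by
    rw [hr]; push_cast; simp
  have hrabs : |(r : ℝ)| ≤ p / T := by
    have : (r : ℝ) = p * (k * ((z.val : ℝ) / p) - j) := by
      rw [hr]; push_cast; field_simp
    rw [this, abs_mul, abs_of_pos hpr, div_eq_mul_one_div (p : ℝ) (T : ℝ)]
    refine mul_le_mul_of_nonneg_left (hkj.trans ?_) hpr.le
    exact one_div_le_one_div_of_le hTr (by linarith)
  have hrp : |r| ≤ p := by
    have : |(r : ℝ)| ≤ p := hrabs.trans (div_le_self hpr.le (by exact_mod_cast hT))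
    exact_mod_cast this
  have hkp : (k : ZMod p) ≠ 0 := by
    intro h
    have := Int.le_of_dvd hk0 ((ZMod.intCast_zmod_eq_zero_iff_dvd _ p).1 h)
    omega
  set S := {t ∈ range M ×ˢ range M | (z + (t.1 : ℕ)) * (z + (t.2 : ℕ)) = κ} with hS
  let f : ℕ × ℕ → ℤ := fun t => k * (t.1 * t.2) + r * (t.1 + t.2)
  have hfib : ∀ n ∈ S.image f, #{t ∈ S | f t = n} ≤ 2 * D := by
    intro n hn
    obtain ⟨t₀, ht₀, hft₀⟩ := mem_image.1 hn
    -- Once the integer value n is fixed, completing the product turns the equation into a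
    -- factorisation of a fixed integer. That integer is nonzero because it is congruent to k²κ.
    have hprod : ∀ t : ℕ × ℕ, f t = n → (r + k * t.1) * (r + k * t.2) = k * n + r ^ 2 := by
      intro t ht
      rw [← ht]; simp only [f]; ring
    set m : ℤ := k * n + r ^ 2 with hm
    have hm0 : m ≠ 0 := by
      intro h0
      have h1 := hprod t₀ hft₀
      have h2 : (((r + k * t₀.1) * (r + k * t₀.2) : ℤ) : ZMod p) = k ^ 2 * κ := by
        rw [← (mem_filter.1 ht₀).2]; push_cast; rw [hrz]; ring
      rw [h1, h0] at h2
      have : (k : ZMod p) ^ 2 * κ ≠ 0 := mul_ne_zero (pow_ne_zero _ hkp) hκ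
      exact this (by simpa using h2.symm)
    have hfac : ∀ a : ℕ, a < M → |r + k * a| ≤ (p : ℤ) ^ 3 := by
      intro a ha
      have h1 : (a : ℤ) ≤ p := by exact_mod_cast (ha.le.trans hM)
      have h2 : k ≤ p := by exact_mod_cast hkT.trans (by exact_mod_cast hTp.le)
      have hp2 : (2 : ℤ) ≤ p := by exact_mod_cast (Fact.out : p.Prime).two_le
      calc |r + k * a| ≤ |r| + |k * a| := abs_add_le _ _
        _ ≤ p + p * p := by
          rw [abs_mul, abs_of_pos hk0, Nat.abs_cast]
          gcongr
        _ ≤ (p : ℤ) ^ 3 := by nlinarith [mul_nonneg (sub_nonneg.2 hp2) (sub_nonneg.2 hp2)]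
    have hmp : m.natAbs ≤ p ^ 6 := by
      have h1 := hprod t₀ hft₀
      have h2 := mem_product.1 (mem_filter.1 ht₀).1
      zify
      rw [← h1, abs_mul]
      calc _ ≤ (p : ℤ) ^ 3 * (p : ℤ) ^ 3 := by
            gcongr
            · exact hfac _ (mem_range.1 h2.1)
            · exact hfac _ (mem_range.1 h2.2)
        _ = _ := by ring
    have hinj : Set.InjOn (fun t : ℕ × ℕ => r + k * (t.1 : ℤ)) (S.filter fun t => f t = n) := by
      intro t ht t' ht' h
      rw [mem_coe, mem_filter] at ht ht'
      have e1 : (t.1 : ℤ) = t'.1 := by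
        have : k * (t.1 : ℤ) = k * t'.1 := by simpa using h
        exact mul_left_cancel₀ hk0.ne' this
      have h1 := hprod t ht.2
      have h2 := hprod t' ht'.2
      rw [← h2, e1] at h1
      have hne : r + k * (t'.1 : ℤ) ≠ 0 := fun h0 => hm0 (by rw [← h2, h0, zero_mul])
      have h3 := mul_left_cancel₀ hne h1
      have e2 : (t.2 : ℤ) = t'.2 := mul_left_cancel₀ hk0.ne' (by simpa using h3)
      ext <;> omega
    rw [← card_image_of_injOn hinj]
    refine (card_le_two_mul_card_divisors hm0 ?_).trans ?_
    · intro x hx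
      obtain ⟨t, ht, rfl⟩ := mem_image.1 hx
      exact ⟨_, (hprod t (mem_filter.1 ht).2).symm⟩
    · have := hD _ (Int.natAbs_ne_zero.2 hm0) hmp
      omega
  have himg : (#(S.image f) : ℝ) ≤ 2 * (T * M ^ 2 + 2 * M * (p / T)) / p + 1 := by
    apply card_le_of_forall_cast_eq hp0 (by positivity) (k * (κ - z ^ 2))
    intro n hn
    obtain ⟨t, ht, rfl⟩ := mem_image.1 hn
    have h2 := mem_product.1 (mem_filter.1 ht).1
    have ha : (t.1 : ℝ) ≤ M := by exact_mod_cast (mem_range.1 h2.1).le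
    have hb : (t.2 : ℝ) ≤ M := by exact_mod_cast (mem_range.1 h2.2).le
    have hkr : (k : ℝ) ≤ T := by exact_mod_cast hkT
    have hk0r : (0 : ℝ) < k := by exact_mod_cast hk0
    constructor
    · simp only [f]; push_cast
      calc |(k : ℝ) * (t.1 * t.2) + r * (t.1 + t.2)|
          ≤ |(k : ℝ) * (t.1 * t.2)| + |(r : ℝ) * (t.1 + t.2)| := abs_add_le _ _
        _ = k * (t.1 * t.2) + |(r : ℝ)| * (t.1 + t.2) := by
            rw [abs_of_nonneg (by positivity), abs_mul,
              abs_of_nonneg (by positivity : (0 : ℝ) ≤ t.1 + t.2)]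
        _ ≤ T * (M * M) + p / T * (M + M) := by gcongr
        _ = _ := by ring
    · rw [← (mem_filter.1 ht).2]
      simp only [f]; push_cast; rw [hrz]; ring
  calc (#S : ℝ) ≤ (2 * D : ℕ) * #(S.image f) := by
        exact_mod_cast card_le_mul_card_image S (2 * D) hfib
    _ ≤ _ := by push_cast; gcongr

/-- Additive energy of the reciprocals of the elements of an interval. -/
lemma card_reciprocal_energy_le {p : ℕ} [Fact p.Prime] {D M T : ℕ}
    (hD : ∀ n : ℕ, n ≠ 0 → n ≤ p ^ 6 → #n.divisors ≤ D) (hM : M ≤ p) (hT : 1 ≤ T) (hTp : T < p)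
    (y : ZMod p) (hy : ∀ t < M, y + (t : ℕ) ≠ 0) :
    (#{q ∈ (range M ×ˢ range M) ×ˢ (range M ×ˢ range M) |
        (y + (q.1.1 : ℕ))⁻¹ + (y + (q.1.2 : ℕ))⁻¹ =
        (y + (q.2.1 : ℕ))⁻¹ + (y + (q.2.2 : ℕ))⁻¹} : ℝ) ≤
      M ^ 2 * (1 + 2 * D * (2 * (T * M ^ 2 + 2 * M * (p / T)) / p + 1)) := by
  set B : ℝ := 2 * D * (2 * (T * M ^ 2 + 2 * M * (p / T)) / p + 1) with hB
  have hB0 : 0 ≤ B := by positivity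
  let g : ℕ × ℕ → ZMod p := fun t => (y + (t.1 : ℕ))⁻¹ + (y + (t.2 : ℕ))⁻¹
  set s := range M ×ˢ range M with hs
  have hinjy : ∀ a < M, ∀ b < M, (y + (a : ℕ) : ZMod p) = y + (b : ℕ) → a = b := by
    intro a ha b hb h
    have h1 : (a : ZMod p) = b := add_left_cancel h
    rw [ZMod.natCast_eq_natCast_iff] at h1
    exact h1.eq_of_lt_of_lt (ha.trans_le hM) (hb.trans_le hM)
  have hzero : #{t ∈ s | g t = 0} ≤ M := by
    have hinj : Set.InjOn (Prod.fst : ℕ × ℕ → ℕ) (s.filter fun t => g t = 0) := by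
      intro t ht t' ht' h
      simp only [mem_coe, mem_filter, hs, mem_product, mem_range, g] at ht ht'
      have e : (y + (t.2 : ℕ))⁻¹ = (y + (t'.2 : ℕ))⁻¹ := by
        have h1 := ht.2
        rw [← ht'.2, h] at h1
        exact add_left_cancel h1
      have := hinjy _ ht.1.2 _ ht'.1.2 (inv_injective e)
      exact Prod.ext h this
    rw [← card_image_of_injOn hinj]
    refine (card_le_card (t := range M) ?_).trans (card_range M).le
    intro a ha
    obtain ⟨t, ht, rfl⟩ := mem_image.1 ha
    exact (mem_product.1 (mem_filter.1 ht).1).1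
  have hnz : ∀ μ ≠ 0, (#{t ∈ s | g t = μ} : ℝ) ≤ B := by
    intro μ hμ
    -- For μ ≠ 0, the equation 1/a + 1/b = μ reads (a - μ⁻¹)(b - μ⁻¹) = μ⁻².
    refine le_trans ?_ (card_hyperbola_le hD hM hT hTp (y - μ⁻¹) (μ⁻¹ ^ 2) (by simpa using hμ))
    norm_cast
    apply card_le_card
    intro t ht
    obtain ⟨ht1, ht2⟩ := mem_filter.1 ht
    refine mem_filter.2 ⟨ht1, ?_⟩
    have h1 := hy _ (mem_range.1 (mem_product.1 ht1).1)
    have h2 := hy _ (mem_range.1 (mem_product.1 ht1).2)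
    simp only [g] at ht2
    rw [← ht2] at hμ ⊢
    set a := y + (t.1 : ℕ)
    set b := y + (t.2 : ℕ)
    have hab : a⁻¹ + b⁻¹ = (a + b) / (a * b) := by field_simp; ring
    rw [hab] at hμ ⊢
    have hab0 : a + b ≠ 0 := fun h => hμ (by rw [h, zero_div])
    rw [show y - ((a + b) / (a * b))⁻¹ + (t.1 : ℕ) = a - (a * b) / (a + b) by
      rw [inv_div]; ring, show y - ((a + b) / (a * b))⁻¹ + (t.2 : ℕ) = b - (a * b) / (a + b) by
      rw [inv_div]; ring, inv_div]
    field_simp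
    ring
  have hsplit : #{q ∈ s ×ˢ s | g q.1 = g q.2} = ∑ t ∈ s, #{t' ∈ s | g t' = g t} := by
    rw [card_filter, sum_product]
    simp only [card_filter, eq_comm]
  change ((#{q ∈ s ×ˢ s | g q.1 = g q.2} : ℕ) : ℝ) ≤ _
  rw [hsplit]; push_cast
  have hcs : (#s : ℝ) = M ^ 2 := by simp [hs, sq]
  calc ∑ t ∈ s, (#{t' ∈ s | g t' = g t} : ℝ)
      ≤ ∑ t ∈ s, (B + if g t = 0 then (M : ℝ) else 0) := by
        refine sum_le_sum fun t _ => ?_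
        split_ifs with h
        · rw [h]
          have : (#{t' ∈ s | g t' = 0} : ℝ) ≤ M := by exact_mod_cast hzero
          linarith
        · simpa using hnz _ h
    _ = M ^ 2 * B + #{t ∈ s | g t = 0} * M := by
        rw [sum_add_distrib, sum_const, nsmul_eq_mul, hcs, ← sum_filter, sum_const, nsmul_eq_mul]
    _ ≤ M ^ 2 * B + M * M := by gcongr
    _ = _ := by ring

/-- The number of solutions of `u₁ / (y + j₁) = u₂ / (y + j₂)` with `u₁, u₂` in a centred
interval. -/
lemma card_ratio_energy_le {p : ℕ} [Fact p.Prime] {D M N : ℕ}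
    (hD : ∀ n : ℕ, n ≠ 0 → n ≤ p ^ 6 → #n.divisors ≤ D) (hM : M ≤ p) (hN : 4 * N ≤ p)
    (hN1 : 1 ≤ N) (y : ZMod p) (hy : ∀ t < M, y + (t : ℕ) ≠ 0) :
    (#{q ∈ (Ioo (-N : ℤ) N ×ˢ Ioo (-N : ℤ) N) ×ˢ (range M ×ˢ range M) |
        q.1.1 ≠ 0 ∧ q.1.2 ≠ 0 ∧
        (q.1.1 : ZMod p) * (y + (q.2.2 : ℕ)) = (q.1.2 : ZMod p) * (y + (q.2.1 : ℕ))} : ℝ) ≤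
      2 * N * M + 8 * D * N * M * (4 * N * M / p + 1) := by
  have hp0 : 0 < p := (Fact.out : p.Prime).pos
  have hpr : (0 : ℝ) < p := by exact_mod_cast hp0
  set S := {q ∈ (Ioo (-N : ℤ) N ×ˢ Ioo (-N : ℤ) N) ×ˢ (range M ×ˢ range M) |
        q.1.1 ≠ 0 ∧ q.1.2 ≠ 0 ∧
        (q.1.1 : ZMod p) * (y + (q.2.2 : ℕ)) = (q.1.2 : ZMod p) * (y + (q.2.1 : ℕ))} with hS
  have hmem : ∀ q ∈ S, ((-(N : ℤ) < q.1.1 ∧ q.1.1 < N) ∧ (-(N : ℤ) < q.1.2 ∧ q.1.2 < N)) ∧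
      (q.2.1 < M ∧ q.2.2 < M) ∧ q.1.1 ≠ 0 ∧ q.1.2 ≠ 0 ∧
      (q.1.1 : ZMod p) * (y + (q.2.2 : ℕ)) = (q.1.2 : ZMod p) * (y + (q.2.1 : ℕ)) := by
    intro q hq
    simpa [hS, and_assoc] using hq
  have heq : ∀ q ∈ S, q.2.1 = q.2.2 → q.1.1 = q.1.2 := by
    intro q hq h
    obtain ⟨⟨⟨a1, a2⟩, b1, b2⟩, ⟨c1, c2⟩, -, -, e⟩ := hmem q hq
    rw [h] at e
    have e1 := mul_right_cancel₀ (hy _ c2) e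
    have e2 : ((q.1.1 - q.1.2 : ℤ) : ZMod p) = 0 := by push_cast; rw [e1, sub_self]
    have e3 := (ZMod.intCast_zmod_eq_zero_iff_dvd _ p).1 e2
    -- The two numerators differ by less than 2N, hence by less than p.
    have e4 := Int.eq_zero_of_abs_lt_dvd e3 (by rw [abs_lt]; constructor <;> omega)
    omega
  have hdiag : #{q ∈ S | q.2.1 = q.2.2} ≤ 2 * N * M := by
    have hinj : Set.InjOn (fun q : (ℤ × ℤ) × (ℕ × ℕ) => (q.1.1, q.2.1))
        (S.filter fun q => q.2.1 = q.2.2) := by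
      intro q hq q' hq' h
      rw [mem_coe, mem_filter] at hq hq'
      simp only [Prod.mk.injEq] at h
      have h1 := heq q hq.1 hq.2
      have h2 := heq q' hq'.1 hq'.2
      ext <;> omega
    rw [← card_image_of_injOn hinj]
    refine (card_le_card (t := Ioo (-N : ℤ) N ×ˢ range M) ?_).trans ?_
    · intro x hx
      obtain ⟨q, hq, rfl⟩ := mem_image.1 hx
      have := hmem q (mem_filter.1 hq).1
      simp [this.1.1, this.2.1.1]
    · rw [card_product, Int.card_Ioo, card_range]
      gcongr
      omega
  -- With v = u₁ - u₂ and w = u₂j₁ - u₁j₂ the equation becomes w ≡ vy modulo p. Given v, w and j₂,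
  -- the pair is recovered from u₂(j₁ - j₂) = w + vj₂, a divisor problem off the diagonal.
  let f : (ℤ × ℤ) × (ℕ × ℕ) → (ℤ × ℤ) × ℕ := fun q =>
    ((q.1.1 - q.1.2, q.1.2 * q.2.1 - q.1.1 * q.2.2), q.2.2)
  set S' := {q ∈ S | q.2.1 ≠ q.2.2} with hS'
  have hfib : ∀ b ∈ S'.image f, #{q ∈ S' | f q = b} ≤ 2 * D := by
    rintro ⟨⟨v, w⟩, j⟩ hb
    obtain ⟨q₀, hq₀, hf₀⟩ := mem_image.1 hb
    have hprod : ∀ q : (ℤ × ℤ) × (ℕ × ℕ), f q = ((v, w), j) →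
        q.1.2 * (q.2.1 - q.2.2) = w + v * j := by
      intro q hq
      simp only [f, Prod.mk.injEq] at hq
      obtain ⟨⟨h1, h2⟩, h3⟩ := hq
      rw [← h1, ← h2, ← h3]; ring
    have h0 := hprod q₀ hf₀
    obtain ⟨⟨-, b1, b2⟩, ⟨c1, c2⟩, -, hne, -⟩ := hmem q₀ (mem_filter.1 hq₀).1
    have hjj := (mem_filter.1 hq₀).2
    have hm0 : w + v * j ≠ 0 := by
      rw [← h0]
      exact mul_ne_zero hne (by omega)
    have hmp : (w + v * j).natAbs ≤ p ^ 6 := by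
      zify
      rw [← h0, abs_mul]
      calc |q₀.1.2| * |(q₀.2.1 : ℤ) - q₀.2.2| ≤ (p : ℤ) * p := by
            gcongr <;> rw [abs_le] <;> constructor <;> omega
        _ = (p : ℤ) ^ 2 := by ring
        _ ≤ (p : ℤ) ^ 6 := by gcongr <;> omega
    have hinj : Set.InjOn (fun q : (ℤ × ℤ) × (ℕ × ℕ) => q.1.2)
        (S'.filter fun q => f q = ((v, w), j)) := by
      intro q hq q' hq' h
      rw [mem_coe, mem_filter] at hq hq'
      dsimp only at h
      have h1 := hprod q hq.2
      have h2 := hprod q' hq'.2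
      have hne' := (hmem q' (mem_filter.1 hq'.1).1).2.2.2.1
      rw [← h2, h] at h1
      have h3 := mul_left_cancel₀ hne' h1
      have h4 := hq.2.trans hq'.2.symm
      simp only [f, Prod.mk.injEq] at h4
      ext <;> omega
    rw [← card_image_of_injOn hinj]
    refine (card_le_two_mul_card_divisors hm0 ?_).trans ?_
    · intro x hx
      obtain ⟨q, hq, rfl⟩ := mem_image.1 hx
      exact ⟨_, (hprod q (mem_filter.1 hq).2).symm⟩
    · have := hD _ (Int.natAbs_ne_zero.2 hm0) hmp
      omega
  have himg : (#(S'.image f) : ℝ) ≤ M * (4 * N * (4 * N * M / p + 1)) := by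
    set V := (S'.image f).image Prod.fst with hV
    have h1 : #(S'.image f) ≤ M * #V := by
      rw [hV]
      refine card_le_mul_card_image _ _ fun b _ => ?_
      have hinj : Set.InjOn (Prod.snd : (ℤ × ℤ) × ℕ → ℕ) ((S'.image f).filter fun q => q.1 = b) := by
        intro q hq q' hq' h
        rw [mem_coe, mem_filter] at hq hq'
        exact Prod.ext (hq.2.trans hq'.2.symm) h
      rw [← card_image_of_injOn hinj]
      refine (card_le_card (t := range M) ?_).trans (card_range M).le
      intro x hx
      obtain ⟨c, hc, rfl⟩ := mem_image.1 hx
      obtain ⟨q, hq, rfl⟩ := mem_image.1 (mem_filter.1 hc).1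
      exact mem_range.2 (hmem q (mem_filter.1 hq).1).2.1.2
    have hVprop : ∀ b ∈ V, (-(2 * N : ℤ) < b.1 ∧ b.1 < 2 * N) ∧ |(b.2 : ℝ)| ≤ 2 * N * M ∧
        (b.2 : ZMod p) = b.1 * y := by
      intro b hb
      obtain ⟨c, hc, rfl⟩ := mem_image.1 hb
      obtain ⟨q, hq, rfl⟩ := mem_image.1 hc
      obtain ⟨⟨⟨a1, a2⟩, b1, b2⟩, ⟨c1, c2⟩, -, -, e⟩ := hmem q (mem_filter.1 hq).1
      refine ⟨⟨by simp only [f]; omega, by simp only [f]; omega⟩, ?_, ?_⟩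
      · have ha : |(q.1.1 : ℝ)| ≤ N := by
          have : |q.1.1| ≤ N := by rw [abs_le]; constructor <;> omega
          exact_mod_cast this
        have hb : |(q.1.2 : ℝ)| ≤ N := by
          have : |q.1.2| ≤ N := by rw [abs_le]; constructor <;> omega
          exact_mod_cast this
        have hc : (q.2.1 : ℝ) ≤ M := by exact_mod_cast c1.le
        have hd : (q.2.2 : ℝ) ≤ M := by exact_mod_cast c2.le
        simp only [f]; push_cast
        calc _ ≤ |(q.1.2 : ℝ) * q.2.1| + |(q.1.1 : ℝ) * q.2.2| := abs_sub _ _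
          _ = |(q.1.2 : ℝ)| * q.2.1 + |(q.1.1 : ℝ)| * q.2.2 := by
            rw [abs_mul, abs_mul, Nat.abs_cast, Nat.abs_cast]
          _ ≤ N * M + N * M := by gcongr
          _ = _ := by ring
      · simp only [f]; push_cast
        linear_combination -e
    -- Fewer than 4N values of v occur, and each confines w to one residue class with |w| ≤ 2NM.
    have h2 : (#V : ℝ) ≤ ∑ _v ∈ Ioo (-(2 * N : ℤ)) (2 * N), (2 * (2 * N * M) / p + 1 : ℝ) := by
      have hmaps : ∀ b ∈ V, b.1 ∈ Ioo (-(2 * N : ℤ)) (2 * N) := fun b hb =>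
        mem_Ioo.2 (hVprop b hb).1
      rw [card_eq_sum_card_fiberwise hmaps]
      push_cast
      refine sum_le_sum fun v _ => ?_
      have hinj : Set.InjOn (Prod.snd : ℤ × ℤ → ℤ) (V.filter fun q => q.1 = v) := by
        intro q hq q' hq' h
        rw [mem_coe, mem_filter] at hq hq'
        exact Prod.ext (hq.2.trans hq'.2.symm) h
      rw [← card_image_of_injOn hinj]
      apply card_le_of_forall_cast_eq hp0 (by positivity) (v * y)
      intro x hx
      obtain ⟨b, hb, rfl⟩ := mem_image.1 hx
      obtain ⟨hb1, hb2⟩ := mem_filter.1 hb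
      have := (hVprop b hb1).2
      rw [hb2] at this
      exact this
    rw [sum_const, Int.card_Ioo, nsmul_eq_mul] at h2
    have h3 : (((2 * N : ℤ) - (-(2 * N : ℤ)) - 1).toNat : ℝ) ≤ 4 * N := by
      have : ((2 * N : ℤ) - (-(2 * N : ℤ)) - 1).toNat ≤ 4 * N := by omega
      exact_mod_cast this
    calc (#(S'.image f) : ℝ) ≤ M * #V := by exact_mod_cast h1
      _ ≤ M * (4 * N * (2 * (2 * N * M) / p + 1)) := by
          gcongr
          refine h2.trans ?_
          gcongr
      _ = _ := by ring
  have hsum : #S = #{q ∈ S | q.2.1 = q.2.2} + #S' :=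
    (card_filter_add_card_filter_not _).symm
  have hS'card : (#S' : ℝ) ≤ (2 * D : ℕ) * #(S'.image f) := by
    exact_mod_cast card_le_mul_card_image S' (2 * D) hfib
  calc (#S : ℝ) = #{q ∈ S | q.2.1 = q.2.2} + #S' := by exact_mod_cast hsum
    _ ≤ (2 * N * M : ℕ) + (2 * D : ℕ) * (M * (4 * N * (4 * N * M / p + 1))) := by
        refine add_le_add (by exact_mod_cast hdiag) (hS'card.trans ?_)
        gcongr
    _ = _ := by push_cast; ring

/-! ### Exponential sums over `ZMod p`. -/

/-- The exponential sum `∑ i ∈ s, e(a g(i) / p)`. -/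
noncomputable def expSum {p : ℕ} [NeZero p] {ι : Type*} (s : Finset ι) (g : ι → ZMod p)
    (a : ZMod p) : ℂ :=
  ∑ i ∈ s, ZMod.stdAddChar (a * g i)

section ExpSum

variable {p : ℕ} {ι κ : Type*}

lemma norm_stdAddChar [NeZero p] (x : ZMod p) : ‖(ZMod.stdAddChar x : ℂ)‖ = 1 :=
  AddChar.norm_apply _ _

lemma conj_stdAddChar [NeZero p] (x : ZMod p) :
    (starRingEnd ℂ) (ZMod.stdAddChar x) = ZMod.stdAddChar (-x) :=
  (AddChar.map_neg_eq_conj _ _).symm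

lemma norm_expSum_le [NeZero p] (s : Finset ι) (g : ι → ZMod p) (a : ZMod p) :
    ‖expSum s g a‖ ≤ #s := by
  refine (norm_sum_le _ _).trans ?_
  simp

lemma expSum_zero_right [NeZero p] (s : Finset ι) (g : ι → ZMod p) : expSum s g 0 = #s := by
  simp [expSum]

lemma norm_expSum_neg [NeZero p] (s : Finset ι) (g : ι → ZMod p) (a : ZMod p) :
    ‖expSum s g (-a)‖ = ‖expSum s g a‖ := by
  rw [← Complex.norm_conj, expSum, expSum, map_sum]
  simp only [conj_stdAddChar, neg_mul, neg_neg]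

lemma expSum_product [NeZero p] (s : Finset ι) (t : Finset κ) (g : ι → ZMod p) (h : κ → ZMod p)
    (a : ZMod p) :
    expSum (s ×ˢ t) (fun q => g q.1 + h q.2) a = expSum s g a * expSum t h a := by
  simp only [expSum]
  rw [sum_mul_sum, sum_product]
  simp only [mul_add, AddChar.map_add_eq_mul]

lemma norm_expSum_const_add [NeZero p] (s : Finset ι) (g : ι → ZMod p) (c a : ZMod p) :
    ‖expSum s (fun i => c + g i) a‖ = ‖expSum s g a‖ := by
  simp only [expSum, mul_add, AddChar.map_add_eq_mul]
  rw [← mul_sum, norm_mul, norm_stdAddChar, one_mul]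

lemma expSum_mul_right [NeZero p] (s : Finset ι) (g : ι → ZMod p) (c a : ZMod p) :
    expSum s (fun i => g i * c) a = expSum s g (a * c) := by
  simp only [expSum]
  exact sum_congr rfl fun i _ => by congr 1; ring

lemma norm_expSum_sq [NeZero p] (s : Finset ι) (g : ι → ZMod p) (a : ZMod p) :
    ((‖expSum s g a‖ ^ 2 : ℝ) : ℂ) =
      ∑ q ∈ s ×ˢ s, ZMod.stdAddChar (a * (g q.1 - g q.2)) := by
  push_cast
  rw [← Complex.mul_conj', expSum, map_sum, sum_mul_sum, sum_product]
  refine sum_congr rfl fun i _ => sum_congr rfl fun j _ => ?_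
  rw [conj_stdAddChar, ← AddChar.map_add_eq_mul]
  congr 1; ring

/-- Parseval's identity. -/
lemma sum_norm_expSum_sq [Fact p.Prime] (s : Finset ι) (g : ι → ZMod p) :
    ∑ a, ‖expSum s g a‖ ^ 2 = p * #{q ∈ s ×ˢ s | g q.1 = g q.2} := by
  have h : ((∑ a, ‖expSum s g a‖ ^ 2 : ℝ) : ℂ) = p * #{q ∈ s ×ˢ s | g q.1 = g q.2} := by
    push_cast
    simp_rw [← Complex.ofReal_pow, norm_expSum_sq]
    rw [sum_comm]
    simp_rw [AddChar.sum_mulShift _ (ZMod.isPrimitive_stdAddChar p), sub_eq_zero, ZMod.card]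
    push_cast
    rw [sum_ite, sum_const_zero, add_zero, sum_const, nsmul_eq_mul, mul_comm]
  exact_mod_cast h

/-- If the nontrivial frequencies carry little mass, then `g` takes more than `p / 2` values. -/
lemma card_image_gt_of_sum_lt [Fact p.Prime] (s : Finset ι) (g : ι → ZMod p)
    (h : ∑ a ∈ univ.erase 0, ‖expSum s g a‖ ^ 2 < (#s : ℝ) ^ 2) : p < 2 * #(s.image g) := by
  have h1 := sum_norm_expSum_sq s g
  rw [← add_sum_erase _ _ (mem_univ (0 : ZMod p)), expSum_zero_right] at h1
  simp only [Complex.norm_natCast] at h1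
  -- Cauchy–Schwarz over the fibres of `g`. By Parseval the hypothesis bounds p times the collision
  -- count by less than 2(#s)².
  have h2 : (#s) ^ 2 ≤ #(s.image g) * #{q ∈ s ×ˢ s | g q.1 = g q.2} := by
    have hE : #{q ∈ s ×ˢ s | g q.1 = g q.2} = ∑ z ∈ s.image g, #{i ∈ s | g i = z} ^ 2 := by
      rw [card_eq_sum_card_fiberwise (f := fun q : ι × ι => g q.1) (t := s.image g)]
      · refine sum_congr rfl fun z _ => ?_
        rw [sq, ← card_product]
        congr 1
        ext q
        simp only [mem_filter, mem_product]
        constructor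
        · rintro ⟨⟨⟨a, b⟩, c⟩, d⟩
          exact ⟨⟨a, d⟩, b, c ▸ d⟩
        · rintro ⟨⟨a, d⟩, b, c⟩
          exact ⟨⟨⟨a, b⟩, d.trans c.symm⟩, d⟩
      · intro q hq
        exact mem_image_of_mem _ (mem_product.1 (mem_filter.1 hq).1).1
    rw [hE, card_eq_sum_card_image g s]
    exact sq_sum_le_card_mul_sum_sq
  set E := #{q ∈ s ×ˢ s | g q.1 = g q.2}
  have h3 : (p : ℝ) * E < 2 * (#s : ℝ) ^ 2 := by linarith
  have h4 : ((#s : ℝ)) ^ 2 ≤ #(s.image g) * E := by exact_mod_cast h2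
  have h5 : (p : ℝ) * E < 2 * #(s.image g) * E := by linarith
  have h6 : (0 : ℝ) ≤ E := by positivity
  have h7 : (p : ℝ) < 2 * #(s.image g) := lt_of_mul_lt_mul_right h5 h6
  exact_mod_cast h7

/-- Both `Z` and l - `Z` fill more than half of the field, so they meet. -/
lemma exists_add_eq_of_card_gt [Fact p.Prime] {Z : Finset (ZMod p)} (h : p < 2 * #Z)
    (l : ZMod p) : ∃ z ∈ Z, ∃ z' ∈ Z, z + z' = l := by
  by_contra! hcon
  have hdisj : Disjoint Z (Z.image fun z => l - z) := by
    rw [disjoint_left]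
    intro z hz hz'
    obtain ⟨w, hw, rfl⟩ := mem_image.1 hz'
    exact hcon _ hz w hw (by ring)
  have h1 : #(Z.image fun z => l - z) = #Z := card_image_of_injective _ sub_right_injective
  have h2 := card_le_univ (Z ∪ Z.image fun z => l - z)
  rw [card_union_of_disjoint hdisj, h1, ZMod.card] at h2
  omega

/-- Centring a Fejér average can only increase the mean of a positive definite function. -/
lemma sum_norm_expSum_shift_le [NeZero p] (s : Finset ι) (g : ι → ZMod p) (H : ℕ) (c a : ZMod p) :
    ∑ q ∈ range H ×ˢ range H, ‖expSum s g (a * (c + (q.1 : ℕ) - (q.2 : ℕ)))‖ ^ 2 ≤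
      ∑ q ∈ range H ×ˢ range H, ‖expSum s g (a * ((q.1 : ℕ) - (q.2 : ℕ)))‖ ^ 2 := by
  -- After the squares are expanded, the shift `c` enters only through phases whose coefficients are
  -- nonnegative squared norms. The triangle inequality removes the phases, leaving the value at c =
  -- 0.
  have key : ∀ c : ZMod p,
      ((∑ q ∈ range H ×ˢ range H, ‖expSum s g (a * (c + (q.1 : ℕ) - (q.2 : ℕ)))‖ ^ 2 : ℝ) : ℂ) =
      ∑ r ∈ s ×ˢ s, ZMod.stdAddChar (a * c * (g r.1 - g r.2)) *
        ((‖expSum (range H) (fun t : ℕ => (t : ZMod p)) (a * (g r.1 - g r.2))‖ ^ 2 : ℝ) : ℂ) := by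
    intro c
    rw [Complex.ofReal_sum]
    simp_rw [norm_expSum_sq]
    rw [sum_comm]
    refine sum_congr rfl fun r _ => ?_
    rw [mul_sum]
    refine sum_congr rfl fun q _ => ?_
    rw [← AddChar.map_add_eq_mul]
    congr 1; ring
  have h0 := key 0
  have hc := key c
  simp only [mul_zero, zero_mul, AddChar.map_zero_eq_one, one_mul, zero_add] at h0
  have h1 := congrArg norm hc
  rw [Complex.norm_real, Real.norm_of_nonneg (by positivity)] at h1
  rw [h1]
  refine (norm_sum_le _ _).trans (le_of_eq ?_)
  have h2 : (∑ q ∈ range H ×ˢ range H, ‖expSum s g (a * ((q.1 : ℕ) - (q.2 : ℕ)))‖ ^ 2 : ℝ) =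
      ∑ r ∈ s ×ˢ s,
        ‖expSum (range H) (fun t : ℕ => (t : ZMod p)) (a * (g r.1 - g r.2))‖ ^ 2 := by
    exact_mod_cast h0
  rw [h2]
  refine sum_congr rfl fun r _ => ?_
  rw [norm_mul, norm_stdAddChar, one_mul, Complex.norm_real, Real.norm_of_nonneg (by positivity)]

/-! ### The Dirichlet kernel and its dilations. -/

/-- The Dirichlet kernel bound. -/
lemma norm_expSum_range_mul_le [NeZero p] (N : ℕ) (b : ZMod p) :
    ‖expSum (range N) (fun t : ℕ => (t : ZMod p)) b‖ * (2 * |(b.valMinAbs : ℝ)|) ≤ p := by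
  have hp : (0 : ℝ) < p := by exact_mod_cast NeZero.pos p
  set v := b.valMinAbs with hv
  have hgeom : expSum (range N) (fun t : ℕ => (t : ZMod p)) b * (ZMod.stdAddChar b - 1) =
      ZMod.stdAddChar b ^ N - 1 := by
    rw [← geom_sum_mul]
    congr 1
    refine sum_congr rfl fun t _ => ?_
    rw [← AddChar.map_nsmul_eq_pow, nsmul_eq_mul, mul_comm]
  have hup : ‖(ZMod.stdAddChar b : ℂ) ^ N - 1‖ ≤ 2 := by
    refine (norm_sub_le _ _).trans ?_
    rw [norm_pow, norm_stdAddChar]; norm_num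
  -- The norm equals 2|sin(πv/p)|, and Jordan's inequality applies because |v| ≤ p/2.
  have hlow : 4 * |(v : ℝ)| / p ≤ ‖(ZMod.stdAddChar b : ℂ) - 1‖ := by
    have h1 : (ZMod.stdAddChar b : ℂ) = Complex.exp (Complex.I * ((2 * Real.pi * v / p : ℝ) : ℂ)) := by
      conv_lhs => rw [← ZMod.coe_valMinAbs b]
      rw [ZMod.stdAddChar_coe]
      congr 1; push_cast; ring
    rw [h1, Complex.norm_exp_I_mul_ofReal_sub_one, norm_mul, Real.norm_eq_abs, Real.norm_eq_abs,
      abs_two]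
    have hvp : |(v : ℝ)| ≤ p / 2 := by
      have h2 := ZMod.natAbs_valMinAbs_le b
      have h3 : v.natAbs * 2 ≤ p := by rw [hv]; omega
      have h4 : ((v.natAbs : ℕ) : ℝ) * 2 ≤ p := by exact_mod_cast h3
      rw [Nat.cast_natAbs, Int.cast_abs] at h4
      linarith
    have habs : |2 * Real.pi * v / p / 2| = Real.pi * |(v : ℝ)| / p := by
      rw [show 2 * Real.pi * v / p / 2 = Real.pi / p * v by ring, abs_mul,
        abs_of_pos (by positivity)]
      ring
    have h5 := Real.mul_abs_le_abs_sin (x := 2 * Real.pi * v / p / 2) (by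
      rw [habs, div_le_div_iff₀ hp two_pos]
      nlinarith [Real.pi_pos])
    rw [habs] at h5
    have h6 : 2 / Real.pi * (Real.pi * |(v : ℝ)| / p) = 2 * |(v : ℝ)| / p := by
      field_simp
    rw [h6] at h5
    calc 4 * |(v : ℝ)| / p = 2 * (2 * |(v : ℝ)| / p) := by ring
      _ ≤ _ := by gcongr
  have h := congrArg norm hgeom
  rw [norm_mul] at h
  have h2 : ‖expSum (range N) (fun t : ℕ => (t : ZMod p)) b‖ * (4 * |(v : ℝ)| / p) ≤ 2 :=
    (mul_le_mul_of_nonneg_left hlow (norm_nonneg _)).trans (h.le.trans hup)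
  rw [mul_div_assoc', div_le_iff₀ hp] at h2
  linarith

/-- Averaging the Dirichlet kernel over the dilations `a / u`. -/
lemma exists_sum_norm_expSum_div_le :
    ∃ C : ℝ, 1 ≤ C ∧ ∀ (p : ℕ) [Fact p.Prime] (D H N : ℕ),
      (∀ n : ℕ, n ≠ 0 → n ≤ p ^ 6 → #n.divisors ≤ D) → H ≤ N → N ≤ p → ∀ a : ZMod p, a ≠ 0 →
      ∑ u ∈ Ico 1 H, ‖expSum (range N) (fun t : ℕ => (t : ZMod p)) (a * (u : ZMod p)⁻¹)‖ ^ 2 ≤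
        C * D * N ^ 2 := by
  -- At k = 0 the second summand is 0 by the convention for division by zero, so w 0 = 4.
  let w : ℤ → ℝ := fun k => (if k = 0 then 4 else 0) + 4 * (1 / (k : ℝ) ^ 2)
  have hw : Summable w :=
    (hasSum_ite_eq 0 4).summable.add ((Real.summable_one_div_int_pow.2 one_lt_two).mul_left 4)
  have hw0 : ∀ k, 0 ≤ w k := fun k => by simp only [w]; positivity
  refine ⟨∑' k, w k, ?_, ?_⟩
  · refine le_trans ?_ (hw.le_tsum 0 fun k _ => hw0 k)
    simp [w]
  intro p _ D H N hD hHN hNp a ha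
  have hp0 : 0 < p := (Fact.out : p.Prime).pos
  have hpr : (0 : ℝ) < p := by exact_mod_cast hp0
  -- All `m u` lie in the class of `a`, and the kernel at a/u is at most pN/(2|m u|). The terms are
  -- sorted by k = ⌊m/p⌋: this quotient determines `m u`, of which u is a divisor, so each k occurs
  -- at most D times.
  let m : ℕ → ℤ := fun u => u * (a * (u : ZMod p)⁻¹).valMinAbs
  have hcast : ∀ u ∈ Ico 1 H, (m u : ZMod p) = a := by
    intro u hu
    obtain ⟨h1, h2⟩ := mem_Ico.1 hu
    have hu0 : (u : ZMod p) ≠ 0 := by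
      rw [Ne, ZMod.natCast_eq_zero_iff]
      exact fun h => by have := Nat.le_of_dvd h1 h; omega
    simp only [m]; push_cast
    field_simp
  have hm0 : ∀ u ∈ Ico 1 H, m u ≠ 0 := fun u hu h => ha (by rw [← hcast u hu, h, Int.cast_zero])
  have hbound : ∀ u ∈ Ico 1 H,
      ‖expSum (range N) (fun t : ℕ => (t : ZMod p)) (a * (u : ZMod p)⁻¹)‖ ^ 2 ≤
        N ^ 2 * w (m u / p) := by
    intro u hu
    obtain ⟨h1, h2⟩ := mem_Ico.1 hu
    set x := ‖expSum (range N) (fun t : ℕ => (t : ZMod p)) (a * (u : ZMod p)⁻¹)‖ with hx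
    set k := m u / p with hk
    have hx0 : 0 ≤ x := norm_nonneg _
    have hxN : x ≤ N := (norm_expSum_le _ _ _).trans (by simp)
    have hxm : x * (2 * |(m u : ℝ)|) ≤ N * p := by
      have := norm_expSum_range_mul_le N (a * (u : ZMod p)⁻¹)
      rw [← hx] at this
      simp only [m]; push_cast
      rw [abs_mul, Nat.abs_cast]
      have huN : (u : ℝ) ≤ N := by exact_mod_cast h2.le.trans hHN
      calc _ = u * (x * (2 * |((a * (u : ZMod p)⁻¹).valMinAbs : ℝ)|)) := by ring
        _ ≤ _ := by gcongr
    have hsmall : 4 ≤ w k → x ^ 2 ≤ N ^ 2 * w k := fun h => by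
      calc x ^ 2 ≤ (N : ℝ) ^ 2 * 1 := by rw [mul_one]; gcongr
        _ ≤ _ := by gcongr; linarith
    -- Only for these k can |m| be far below p, and there the trivial bound N suffices. Otherwise
    -- |m| ≥ |k|p/2.
    by_cases hk1 : k = 0 ∨ k = -1
    · apply hsmall
      rcases hk1 with h | h <;> rw [h] <;> simp [w]
    push Not at hk1
    have hkm : |(k : ℝ)| * p ≤ 2 * |(m u : ℝ)| := by
      have e := Int.emod_add_mul_ediv (m u) p
      have e1 := Int.emod_nonneg (m u) (show (p : ℤ) ≠ 0 by omega)
      have e2 := Int.emod_lt_of_pos (m u) (show (0 : ℤ) < p by omega)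
      rw [← hk] at e
      have hz : |k| * p ≤ 2 * |m u| := by
        rcases lt_or_gt_of_ne hk1.1 with h | h
        · have hk2 : k ≤ -2 := by omega
          rw [abs_of_neg h]
          have := neg_le_abs (m u)
          nlinarith
        · rw [abs_of_pos h]
          have := le_abs_self (m u)
          nlinarith
      exact_mod_cast hz
    have hxk : x * |(k : ℝ)| ≤ N := by
      have : x * (|(k : ℝ)| * p) ≤ N * p := (mul_le_mul_of_nonneg_left hkm hx0).trans hxm
      exact le_of_mul_le_mul_right (by linarith) hpr
    have hk0 : (0 : ℝ) < (k : ℝ) ^ 2 := by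
      have : (k : ℝ) ≠ 0 := by exact_mod_cast hk1.1
      positivity
    have hsq : x ^ 2 * (k : ℝ) ^ 2 ≤ N ^ 2 := by
      rw [← sq_abs (k : ℝ), ← mul_pow]
      gcongr
    calc x ^ 2 ≤ N ^ 2 * (1 / (k : ℝ) ^ 2) := by
          rw [mul_one_div, le_div_iff₀ hk0]; exact hsq
      _ ≤ N ^ 2 * w k := by
          gcongr
          simp only [w, if_neg hk1.1]
          have : 0 ≤ 1 / (k : ℝ) ^ 2 := by positivity
          linarith
  have hfib : ∀ k ∈ (Ico 1 H).image (fun u => m u / (p : ℤ)),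
      #{u ∈ Ico 1 H | m u / (p : ℤ) = k} ≤ D := by
    intro k hk
    obtain ⟨u₀, hu₀, hk₀⟩ := mem_image.1 hk
    have hsame : ∀ u ∈ Ico 1 H, m u / (p : ℤ) = k → m u = m u₀ := by
      intro u hu h
      rw [← Int.emod_add_mul_ediv (m u) p, ← Int.emod_add_mul_ediv (m u₀) p, h]
      rw [hk₀]
      congr 1
      have : (m u : ZMod p) = m u₀ := by rw [hcast u hu, hcast u₀ hu₀]
      exact (ZMod.intCast_eq_intCast_iff _ _ _).1 this
    refine (card_le_card (t := (m u₀).natAbs.divisors) ?_).trans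
      (hD _ (Int.natAbs_ne_zero.2 (hm0 u₀ hu₀)) ?_)
    · intro u hu
      obtain ⟨hu1, hu2⟩ := mem_filter.1 hu
      rw [Nat.mem_divisors]
      refine ⟨?_, Int.natAbs_ne_zero.2 (hm0 u₀ hu₀)⟩
      rw [← hsame u hu1 hu2]
      simp only [m, Int.natAbs_mul, Int.natAbs_natCast]
      exact dvd_mul_right _ _
    · simp only [m, Int.natAbs_mul, Int.natAbs_natCast]
      have h1 := ZMod.natAbs_valMinAbs_le (a * (u₀ : ZMod p)⁻¹)
      have h2 := (mem_Ico.1 hu₀).2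
      calc _ ≤ p * p := by gcongr <;> omega
        _ = p ^ 2 := by ring
        _ ≤ p ^ 6 := by gcongr; all_goals omega
  calc _ ≤ ∑ u ∈ Ico 1 H, N ^ 2 * w (m u / p) := sum_le_sum hbound
    _ = ∑ k ∈ (Ico 1 H).image (fun u => m u / (p : ℤ)),
          ∑ u ∈ Ico 1 H with m u / (p : ℤ) = k, N ^ 2 * w (m u / p) :=
        (sum_fiberwise_of_maps_to (fun u hu => mem_image_of_mem _ hu) _).symm
    _ ≤ ∑ k ∈ (Ico 1 H).image (fun u => m u / (p : ℤ)), D * (N ^ 2 * w k) := by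
        refine sum_le_sum fun k hk => ?_
        rw [sum_congr rfl (g := fun _ => N ^ 2 * w k) (fun u hu => by rw [(mem_filter.1 hu).2]),
          sum_const, nsmul_eq_mul]
        have := hw0 k
        gcongr
        exact hfib k hk
    _ = D * N ^ 2 * ∑ k ∈ (Ico 1 H).image (fun u => m u / (p : ℤ)), w k := by
        rw [mul_sum]; exact sum_congr rfl fun _ _ => by ring
    _ ≤ D * N ^ 2 * ∑' k, w k := by
        gcongr
        exact hw.sum_le_tsum _ fun k _ => hw0 k
    _ = _ := by ring

end ExpSum

/-! ### The averaged estimate and the variance of the Fejér average. -/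

/-- The average of an even nonnegative function over differences of `[0, H)`. -/
lemma sum_sub_le_of_even {R : Type*} [CommRing R] {f : R → ℝ} (hf0 : ∀ b, 0 ≤ f b)
    (hfneg : ∀ b, f (-b) = f b) (H : ℕ) :
    ∑ q ∈ range H ×ˢ range H, f ((q.1 : ℕ) - (q.2 : ℕ)) ≤
      H * f 0 + 2 * H * ∑ u ∈ Ico 1 H, f (u : ℕ) := by
  have hle : ∀ (s : Finset ℕ) (i : ℕ → ℕ), Set.InjOn i s → (∀ t ∈ s, i t ∈ Ico 1 H) →
      ∑ t ∈ s, f (i t : ℕ) ≤ ∑ u ∈ Ico 1 H, f (u : ℕ) := by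
    intro s i hi hmaps
    rw [← sum_image (f := fun u : ℕ => f (u : R)) hi]
    exact sum_le_sum_of_subset_of_nonneg (image_subset_iff.2 hmaps) fun _ _ _ => hf0 _
  rw [sum_product]
  calc ∑ s ∈ range H, ∑ t ∈ range H, f ((s : ℕ) - (t : ℕ))
      ≤ ∑ s ∈ range H, (f 0 + 2 * ∑ u ∈ Ico 1 H, f (u : ℕ)) := by
        refine sum_le_sum fun s hs => ?_
        have hsH := mem_range.1 hs
        rw [← sum_filter_add_sum_filter_not (range H) (fun t => t < s),
          ← sum_filter_add_sum_filter_not ({t ∈ range H | ¬ t < s}) (fun t => t = s)]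
        have h1 : ∑ t ∈ range H with t < s, f ((s : ℕ) - (t : ℕ)) ≤ ∑ u ∈ Ico 1 H, f (u : ℕ) := by
          refine le_trans (le_of_eq ?_) (hle {t ∈ range H | t < s} (fun t => s - t) ?_ ?_)
          · refine sum_congr rfl fun t ht => ?_
            rw [Nat.cast_sub (mem_filter.1 ht).2.le]
          · intro t ht t' ht' h
            rw [mem_coe, mem_filter, mem_range] at ht ht'
            dsimp only at h
            omega
          · intro t ht
            rw [mem_filter, mem_range] at ht
            rw [mem_Ico]
            omega
        have h2 : ∑ t ∈ {t ∈ range H | ¬ t < s} with t = s, f ((s : ℕ) - (t : ℕ)) = f 0 := by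
          have : {t ∈ {t ∈ range H | ¬ t < s} | t = s} = {s} := by
            ext t
            simp only [mem_filter, mem_range, mem_singleton]
            constructor
            · exact fun h => h.2
            · rintro rfl; exact ⟨⟨hsH, lt_irrefl _⟩, rfl⟩
          rw [this, sum_singleton, sub_self]
        have h3 : ∑ t ∈ {t ∈ range H | ¬ t < s} with ¬ t = s, f ((s : ℕ) - (t : ℕ)) ≤
            ∑ u ∈ Ico 1 H, f (u : ℕ) := by
          refine le_trans (le_of_eq ?_)
            (hle {t ∈ {t ∈ range H | ¬ t < s} | ¬ t = s} (fun t => t - s) ?_ ?_)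
          · refine sum_congr rfl fun t ht => ?_
            rw [mem_filter, mem_filter] at ht
            rw [Nat.cast_sub (not_lt.1 ht.1.2), ← hfneg, neg_sub]
          · intro t ht t' ht' h
            rw [mem_coe, mem_filter, mem_filter, mem_range] at ht ht'
            dsimp only at h
            omega
          · intro t ht
            rw [mem_filter, mem_filter, mem_range] at ht
            rw [mem_Ico]
            omega
        rw [h2]
        linarith
    _ = _ := by rw [sum_const, card_range, nsmul_eq_mul]; ring

lemma sum_mul_right_eq {p : ℕ} [Fact p.Prime] (f : ZMod p → ℝ) {x : ZMod p} (hx : x ≠ 0) :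
    ∑ a, f (a * x) = ∑ a, f a :=
  Fintype.sum_equiv (Equiv.mulRight₀ x hx) _ _ fun _ => rfl

/-- The averaged energy estimate in abstract form: `d` plays the role of a Fejér kernel, `k` of a
positive definite function, and `F` of an average of dilates of `d`. -/
lemma sum_kernel_le {p : ℕ} [Fact p.Prime] {H N M : ℕ} {d k : ZMod p → ℝ} {Y : ℕ → ZMod p}
    {c : ZMod p} {Λ : ℝ} (hHp : H ≤ p) (hd0 : ∀ b, 0 ≤ d b) (hdN : ∀ b, d b ≤ N ^ 2)
    (hk0 : ∀ b, 0 ≤ k b) (hkneg : ∀ b, k (-b) = k b) (hkz : k 0 = M ^ 4)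
    (hY : ∀ j < M, Y j ≠ 0)
    (hc : ∀ q ∈ range H ×ˢ range H, c + (q.1 : ℕ) - (q.2 : ℕ) ≠ 0)
    (hshift : ∀ a, ∑ q ∈ range H ×ˢ range H, k (a * (c + (q.1 : ℕ) - (q.2 : ℕ))) ≤
      ∑ q ∈ range H ×ˢ range H, k (a * ((q.1 : ℕ) - (q.2 : ℕ))))
    (hΛ : ∀ a ≠ 0, ∑ u ∈ Ico 1 H, d (a * (u : ZMod p)⁻¹) ≤ Λ * N ^ 2) :
    ∑ r ∈ (range M ×ˢ range M) ×ˢ (range H ×ˢ range H), ∑ a ∈ univ.erase 0,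
        d (a * (Y r.1.1)⁻¹) * d (a * (Y r.1.2)⁻¹) * k (a * (c + (r.2.1 : ℕ) - (r.2.2 : ℕ))) ≤
      6 * N ^ 2 * M ^ 2 * H ^ 2 * (∑ a, k a) +
      2 * H * M ^ 4 * (∑ a, ((∑ j ∈ range M, d (a * (Y j)⁻¹)) - N * M) ^ 2) +
      4 * H * M ^ 2 * N ^ 4 * Λ * ∑ a, k a := by
  set F : ZMod p → ℝ := fun a => ∑ j ∈ range M, d (a * (Y j)⁻¹) with hF
  set W : ZMod p → ℝ := fun a =>
    ∑ q ∈ range H ×ˢ range H, k (a * (c + (q.1 : ℕ) - (q.2 : ℕ))) with hW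
  set Q := ∑ a, k a with hQ
  have hF0 : ∀ a, 0 ≤ F a := fun a => sum_nonneg fun _ _ => hd0 _
  have hW0 : ∀ a, 0 ≤ W a := fun a => sum_nonneg fun _ _ => hk0 _
  have hFM : ∀ a, F a ≤ M * N ^ 2 := fun a => by
    refine (sum_le_sum fun _ _ => hdN _).trans ?_
    rw [sum_const, card_range, nsmul_eq_mul]
  have hWle : ∀ a, W a ≤ H * M ^ 4 + 2 * H * ∑ u ∈ Ico 1 H, k (a * (u : ℕ)) := by
    intro a
    refine (hshift a).trans ?_
    have := sum_sub_le_of_even (f := fun b => k (a * b)) (fun _ => hk0 _)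
      (fun b => by rw [mul_neg, hkneg]) H
    simpa only [mul_zero, hkz] using this
  have hWsum : ∑ a, W a = H ^ 2 * Q := by
    rw [hW, sum_comm, sum_congr rfl fun q hq => sum_mul_right_eq k (hc q hq), sum_const,
      card_product, card_range, nsmul_eq_mul]
    push_cast; ring
  have hu0 : ∀ u ∈ Ico 1 H, (u : ZMod p) ≠ 0 := by
    intro u hu
    obtain ⟨h1, h2⟩ := mem_Ico.1 hu
    rw [Ne, ZMod.natCast_eq_zero_iff]
    exact fun h => by have := Nat.le_of_dvd h1 h; omega
  -- Replacing a by a/u moves the dilation from `k` to `F`, where `hΛ` applies to each j.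
  have hFk : ∑ a ∈ univ.erase 0, ∑ u ∈ Ico 1 H, F a * k (a * (u : ℕ)) ≤ M * Λ * N ^ 2 * Q := by
    calc ∑ a ∈ univ.erase 0, ∑ u ∈ Ico 1 H, F a * k (a * (u : ℕ))
        = ∑ u ∈ Ico 1 H, ∑ a ∈ univ.erase 0, F (a * (u : ZMod p)⁻¹) * k a := by
          rw [sum_comm]
          refine sum_congr rfl fun u hu => ?_
          refine sum_equiv (Equiv.mulRight₀ (u : ZMod p) (hu0 u hu)) ?_ ?_
          · intro a; simp [hu0 u hu]
          · intro a _
            simp [mul_assoc, mul_inv_cancel₀ (hu0 u hu)]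
      _ = ∑ a ∈ univ.erase 0, (∑ u ∈ Ico 1 H, F (a * (u : ZMod p)⁻¹)) * k a := by
          rw [sum_comm]; simp only [sum_mul]
      _ ≤ ∑ a ∈ univ.erase 0, (M * (Λ * N ^ 2)) * k a := by
          refine sum_le_sum fun a ha => mul_le_mul_of_nonneg_right ?_ (hk0 a)
          simp only [hF]
          rw [sum_comm]
          calc _ ≤ ∑ _j ∈ range M, Λ * N ^ 2 := by
                refine sum_le_sum fun j hj => ?_
                have := hΛ (a * (Y j)⁻¹)
                  (mul_ne_zero (ne_of_mem_erase ha) (inv_ne_zero (hY j (mem_range.1 hj))))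
                refine le_trans (le_of_eq ?_) this
                exact sum_congr rfl fun u _ => by congr 1; ring
            _ = _ := by rw [sum_const, card_range, nsmul_eq_mul]
      _ = (M * (Λ * N ^ 2)) * ∑ a ∈ univ.erase 0, k a := by rw [mul_sum]
      _ ≤ (M * (Λ * N ^ 2)) * Q := by
          refine mul_le_mul_of_nonneg_left
            (sum_le_sum_of_subset_of_nonneg (subset_univ _) fun _ _ _ => hk0 _) ?_
          have h1 := hΛ 1 one_ne_zero
          have h2 : 0 ≤ Λ * N ^ 2 := (sum_nonneg fun _ _ => hd0 _).trans h1
          positivity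
      _ = _ := by ring
  have hkk : ∑ a ∈ univ.erase 0, ∑ u ∈ Ico 1 H, k (a * (u : ℕ)) ≤ H * Q := by
    calc _ ≤ ∑ a, ∑ u ∈ Ico 1 H, k (a * (u : ℕ)) :=
          sum_le_sum_of_subset_of_nonneg (subset_univ _) fun _ _ _ => sum_nonneg fun _ _ => hk0 _
      _ = ∑ u ∈ Ico 1 H, Q := by
          rw [sum_comm]
          exact sum_congr rfl fun u hu => sum_mul_right_eq k (hu0 u hu)
      _ ≤ H * Q := by
          rw [sum_const, nsmul_eq_mul, Nat.card_Ico]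
          have : 0 ≤ Q := sum_nonneg fun _ _ => hk0 _
          gcongr
          exact Nat.sub_le _ _
  have hLHS : ∑ r ∈ (range M ×ˢ range M) ×ˢ (range H ×ˢ range H), ∑ a ∈ univ.erase 0,
        d (a * (Y r.1.1)⁻¹) * d (a * (Y r.1.2)⁻¹) * k (a * (c + (r.2.1 : ℕ) - (r.2.2 : ℕ))) =
      ∑ a ∈ univ.erase 0, F a ^ 2 * W a := by
    rw [sum_comm]
    refine sum_congr rfl fun a _ => ?_
    simp only [hF, hW]
    have hsq : (∑ j ∈ range M, d (a * (Y j)⁻¹)) ^ 2 =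
        ∑ q ∈ range M ×ˢ range M, d (a * (Y q.1)⁻¹) * d (a * (Y q.2)⁻¹) := by
      rw [sq, sum_mul_sum, sum_product]
    rw [hsq, sum_mul_sum, sum_product]
  rw [hLHS]
  -- `F` is split into its typical size NM and a deviation. Against the constant part HM⁴ of the
  -- bound for `W` the deviation keeps its mean square; against the sum over u the crude (F - NM)² ≤
  -- MN²F + (NM)² is enough.
  have hpt : ∀ a, F a ^ 2 * W a ≤ 2 * N ^ 2 * M ^ 2 * W a + 2 * H * M ^ 4 * (F a - N * M) ^ 2 +
      4 * H * (N ^ 2 * M ^ 2) * (∑ u ∈ Ico 1 H, k (a * (u : ℕ))) +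
      4 * H * (M * N ^ 2) * ∑ u ∈ Ico 1 H, F a * k (a * (u : ℕ)) := by
    intro a
    rw [← mul_sum]
    set S := ∑ u ∈ Ico 1 H, k (a * (u : ℕ))
    have hS0 : 0 ≤ S := sum_nonneg fun _ _ => hk0 _
    have e1 : F a ^ 2 ≤ 2 * (N * M) ^ 2 + 2 * (F a - N * M) ^ 2 := by
      nlinarith [sq_nonneg (F a - N * M - N * M)]
    have e2 : (F a - N * M) ^ 2 ≤ M * N ^ 2 * F a + (N * M) ^ 2 := by
      have := mul_le_mul_of_nonneg_right (hFM a) (hF0 a)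
      have h3 : 0 ≤ F a * (N * M : ℝ) := mul_nonneg (hF0 a) (by positivity)
      nlinarith
    calc F a ^ 2 * W a ≤ (2 * (N * M) ^ 2 + 2 * (F a - N * M) ^ 2) * W a :=
          mul_le_mul_of_nonneg_right e1 (hW0 a)
      _ = 2 * (N * M) ^ 2 * W a + 2 * (F a - N * M) ^ 2 * W a := by ring
      _ ≤ 2 * (N * M) ^ 2 * W a + 2 * (F a - N * M) ^ 2 * (H * M ^ 4 + 2 * H * S) := by
          gcongr; exact hWle a
      _ = 2 * (N * M) ^ 2 * W a + 2 * H * M ^ 4 * (F a - N * M) ^ 2 +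
            4 * H * ((F a - N * M) ^ 2) * S := by ring
      _ ≤ 2 * (N * M) ^ 2 * W a + 2 * H * M ^ 4 * (F a - N * M) ^ 2 +
            4 * H * (M * N ^ 2 * F a + (N * M) ^ 2) * S := by gcongr
      _ = _ := by ring
  have hsub : ∀ f : ZMod p → ℝ, (∀ a, 0 ≤ f a) → ∑ a ∈ univ.erase 0, f a ≤ ∑ a, f a :=
    fun f hf => sum_le_sum_of_subset_of_nonneg (subset_univ _) fun _ _ _ => hf _
  refine (sum_le_sum fun a _ => hpt a).trans ?_
  rw [sum_add_distrib, sum_add_distrib, sum_add_distrib, ← mul_sum, ← mul_sum, ← mul_sum,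
    ← mul_sum]
  calc _ ≤ 2 * N ^ 2 * M ^ 2 * (H ^ 2 * Q) + 2 * H * M ^ 4 * (∑ a, (F a - N * M) ^ 2) +
        4 * H * (N ^ 2 * M ^ 2) * (H * Q) + 4 * H * (M * N ^ 2) * (M * Λ * N ^ 2 * Q) := by
        rw [← hWsum]
        refine add_le_add (add_le_add (add_le_add ?_ ?_) ?_) ?_ <;>
          refine mul_le_mul_of_nonneg_left ?_ (by positivity)
        · exact hsub W hW0
        · exact hsub _ fun _ => sq_nonneg _
        · exact hkk
        · exact hFk
    _ = _ := by ring

/-- Variance of the average of dilated Fejér kernels. -/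
lemma sum_fejer_variance_le {p : ℕ} [Fact p.Prime] {D M N : ℕ}
    (hD : ∀ n : ℕ, n ≠ 0 → n ≤ p ^ 6 → #n.divisors ≤ D) (hM : M ≤ p) (hN : 4 * N ≤ p)
    (hN1 : 1 ≤ N) (y : ZMod p) (hy : ∀ t < M, y + (t : ℕ) ≠ 0) :
    ∑ a, ((∑ j ∈ range M, ‖expSum (range N) (fun t : ℕ => (t : ZMod p)) (a * (y + (j : ℕ))⁻¹)‖ ^ 2) -
        N * M) ^ 2 ≤
      p * (N ^ 2 * (2 * N * M + 8 * D * N * M * (4 * N * M / p + 1))) := by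
  -- Subtracting NM removes exactly the diagonal pairs, so the deviation is itself an exponential
  -- sum and Parseval applies to it.
  set s : Finset (ℕ × (ℕ × ℕ)) := range M ×ˢ {t ∈ range N ×ˢ range N | ¬ t.1 = t.2} with hs
  let g : ℕ × (ℕ × ℕ) → ZMod p := fun q => (y + (q.1 : ℕ))⁻¹ * ((q.2.1 : ℕ) - (q.2.2 : ℕ))
  have hmem : ∀ q ∈ s, q.1 < M ∧ q.2.1 < N ∧ q.2.2 < N ∧ q.2.1 ≠ q.2.2 := by
    intro q hq
    simpa [hs, and_assoc] using hq
  have hexp : ∀ a, (((∑ j ∈ range M,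
      ‖expSum (range N) (fun t : ℕ => (t : ZMod p)) (a * (y + (j : ℕ))⁻¹)‖ ^ 2) - N * M : ℝ) : ℂ) =
      expSum s g a := by
    intro a
    rw [Complex.ofReal_sub, Complex.ofReal_sum, expSum, hs, sum_product, sub_eq_iff_eq_add]
    have hdiag : ((N * M : ℝ) : ℂ) = ∑ j ∈ range M, (N : ℂ) := by
      rw [sum_const, card_range, nsmul_eq_mul]; push_cast; ring
    rw [hdiag, ← sum_add_distrib]
    refine sum_congr rfl fun j _ => ?_
    rw [norm_expSum_sq, ← sum_filter_add_sum_filter_not (range N ×ˢ range N) (fun t => t.1 = t.2),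
      add_comm]
    congr 1
    · refine sum_congr rfl fun t _ => ?_
      rw [mul_assoc]
    · have hcard : #{t ∈ range N ×ˢ range N | t.1 = t.2} = N := by
        rw [show {t ∈ range N ×ˢ range N | t.1 = t.2} = (range N).image fun t => (t, t) by
          ext ⟨a, b⟩
          simp only [mem_filter, mem_product, mem_range, mem_image, Prod.mk.injEq]
          constructor
          · rintro ⟨⟨h1, h2⟩, h⟩; exact ⟨a, h1, rfl, h⟩
          · rintro ⟨t, h1, rfl, rfl⟩; exact ⟨⟨h1, h1⟩, rfl⟩,
          card_image_of_injective _ (fun a b h => (Prod.mk.inj h).1), card_range]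
      rw [sum_congr rfl (g := fun _ => (1 : ℂ)), sum_const, hcard, nsmul_eq_mul, mul_one]
      intro t ht
      rw [(mem_filter.1 ht).2, sub_self, mul_zero, AddChar.map_zero_eq_one]
  have hsq : ∀ a, ((∑ j ∈ range M,
      ‖expSum (range N) (fun t : ℕ => (t : ZMod p)) (a * (y + (j : ℕ))⁻¹)‖ ^ 2) - N * M) ^ 2 =
      ‖expSum s g a‖ ^ 2 := by
    intro a
    rw [← hexp, Complex.norm_real, Real.norm_eq_abs, sq_abs]
  rw [sum_congr rfl fun a _ => hsq a, sum_norm_expSum_sq]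
  set E := {q ∈ s ×ˢ s | g q.1 = g q.2} with hE
  set R := {q ∈ (Ioo (-N : ℤ) N ×ˢ Ioo (-N : ℤ) N) ×ˢ (range M ×ˢ range M) |
        q.1.1 ≠ 0 ∧ q.1.2 ≠ 0 ∧
        (q.1.1 : ZMod p) * (y + (q.2.2 : ℕ)) = (q.1.2 : ZMod p) * (y + (q.2.1 : ℕ))} with hR
  have hcardE : #E ≤ N ^ 2 * #R := by
    -- Each pair of elements is recorded by its difference and its second entry; the two second
    -- entries account for N².
    let f : (ℕ × (ℕ × ℕ)) × (ℕ × (ℕ × ℕ)) → (ℕ × ℕ) × ((ℤ × ℤ) × (ℕ × ℕ)) := fun q =>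
      ((q.1.2.2, q.2.2.2),
        (((q.1.2.1 : ℤ) - q.1.2.2, (q.2.2.1 : ℤ) - q.2.2.2), (q.1.1, q.2.1)))
    have h1 : #E ≤ #((range N ×ˢ range N) ×ˢ R) := by
      refine card_le_card_of_injOn f ?_ ?_
      · intro q hq
        rw [mem_coe, hE, mem_filter, mem_product] at hq
        obtain ⟨⟨ha, hb⟩, hg⟩ := hq
        obtain ⟨a1, a2, a3, a4⟩ := hmem _ ha
        obtain ⟨b1, b2, b3, b4⟩ := hmem _ hb
        simp only [f, hR, mem_coe, mem_product, mem_filter, mem_range, mem_Ioo]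
        refine ⟨⟨a3, b3⟩, ⟨⟨⟨by omega, by omega⟩, by omega, by omega⟩, a1, b1⟩, by omega, by omega, ?_⟩
        simp only [g] at hg
        have hy1 := hy _ a1
        have hy2 := hy _ b1
        push_cast
        rw [inv_mul_eq_div, inv_mul_eq_div, div_eq_div_iff hy1 hy2] at hg
        exact hg
      · intro q hq q' hq' h
        simp only [f, Prod.mk.injEq] at h
        ext <;> omega
    rwa [card_product, card_product, card_range, ← sq] at h1
  have hRle := card_ratio_energy_le hD hM hN hN1 y hy
  rw [← hR] at hRle
  have h2 : (#E : ℝ) ≤ N ^ 2 * #R := by exact_mod_cast hcardE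
  refine mul_le_mul_of_nonneg_left (h2.trans ?_) (by positivity)
  gcongr

/-! ### Numerical comparison of the error terms. -/

/-- The energy bound leaves three terms, each to be kept below a third of the target. `T` is of
order H/(CD²), the largest that the term in TM² permits; `hyp1` then makes THM large enough for the
term in p/T, and `hyp2` takes care of the term in p. -/
lemma sum_reciprocal_moment_le {p : ℕ} [Fact p.Prime] {D H M : ℕ} {C : ℝ} {y : ZMod p}
    (hD1 : 1 ≤ D) (hD : ∀ n : ℕ, n ≠ 0 → n ≤ p ^ 6 → #n.divisors ≤ D) (hHp : 8 * H ≤ p)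
    (hMp : M ≤ p) (hH1 : 1 ≤ H) (hM1 : 1 ≤ M) (hC1 : 1 ≤ C)
    (hyne : ∀ t < M, y + (t : ℕ) ≠ 0) (hHD : 512 * C * D ^ 2 ≤ H)
    (hyp1 : (512 * C) ^ 2 * p * D ^ 4 ≤ (H : ℝ) ^ 2 * M)
    (hyp2 : (512 * C) ^ 2 * p * D ^ 2 ≤ (H : ℝ) * M ^ 2) :
    16 * C * D * (∑ a, ‖expSum (range M ×ˢ range M)
      (fun t : ℕ × ℕ => (y + (t.1 : ℕ))⁻¹ + (y + (t.2 : ℕ))⁻¹) a‖ ^ 2) ≤ H * M ^ 4 := by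
  have hpr : (0 : ℝ) < p := by exact_mod_cast (Fact.out : p.Prime).pos
  have hDr : (1 : ℝ) ≤ D := by exact_mod_cast hD1
  have hHr : (1 : ℝ) ≤ H := by exact_mod_cast hH1
  have hMr : (1 : ℝ) ≤ M := by exact_mod_cast hM1
  have hC0 : 0 < C := by linarith
  set recip : ℕ × ℕ → ZMod p := fun t => (y + (t.1 : ℕ))⁻¹ + (y + (t.2 : ℕ))⁻¹ with hrecip
  set P := range M ×ˢ range M with hP
  set T := ⌊(H : ℝ) / (192 * C * D ^ 2)⌋₊ with hT
  have hden : 0 < 192 * C * (D : ℝ) ^ 2 := by positivity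
  have hquot : 2 ≤ (H : ℝ) / (192 * C * D ^ 2) := by
    rw [le_div_iff₀ hden]; nlinarith [mul_pos hC0 (by positivity : (0 : ℝ) < (D : ℝ) ^ 2)]
  have hT1 : 1 ≤ T := Nat.le_floor (by push_cast; linarith)
  have hTr : (1 : ℝ) ≤ T := by exact_mod_cast hT1
  have hTle : 192 * C * D ^ 2 * T ≤ H := by
    have := Nat.floor_le (show 0 ≤ (H : ℝ) / (192 * C * D ^ 2) by positivity)
    rw [← hT, le_div_iff₀ hden] at this
    linarith
  have hTge : (H : ℝ) ≤ 384 * C * D ^ 2 * T := by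
    have := Nat.lt_floor_add_one ((H : ℝ) / (192 * C * D ^ 2))
    rw [← hT, div_lt_iff₀ hden] at this
    nlinarith
  have hTp : T < p := by
    have h1 : (T : ℝ) ≤ H := by
      have : (1 : ℝ) ≤ 192 * C * D ^ 2 := by nlinarith
      nlinarith
    have h2 : T ≤ H := by exact_mod_cast h1
    omega
  have hE := card_reciprocal_energy_le hD hMp hT1 hTp y hyne
  rw [sum_norm_expSum_sq]
  set E := #{q ∈ P ×ˢ P | recip q.1 = recip q.2} with hEdef
  change ((E : ℕ) : ℝ) ≤ _ at hE
  have hE' : (p : ℝ) * E ≤ D * M ^ 2 * (3 * p + 4 * T * M ^ 2 + 8 * M * p / T) := by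
    calc (p : ℝ) * E ≤ p * (M ^ 2 * (1 + 2 * D * (2 * (T * M ^ 2 + 2 * M * (p / T)) / p + 1))) :=
          mul_le_mul_of_nonneg_left hE hpr.le
      _ ≤ p * (M ^ 2 * (D + 2 * D * (2 * (T * M ^ 2 + 2 * M * (p / T)) / p + 1))) := by gcongr
      _ = _ := by field_simp; ring
  have hthird : 384 * C * D ^ 2 * p ≤ T * H * M := by
    have h1 : 384 * C * D ^ 2 * (384 * C * D ^ 2 * p) ≤ 384 * C * D ^ 2 * (T * H * M) := by
      calc _ = (384 * C) ^ 2 * p * (D : ℝ) ^ 4 := by ring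
        _ ≤ (512 * C) ^ 2 * p * (D : ℝ) ^ 4 := by gcongr; norm_num
        _ ≤ H * H * M := by linarith
        _ ≤ (384 * C * D ^ 2 * T) * H * M := by gcongr
        _ = _ := by ring
    exact le_of_mul_le_mul_left h1 (by positivity)
  have e1 : 16 * C * D ^ 2 * (3 * p) ≤ H * M ^ 2 / 3 := by
    have : 144 * C * D ^ 2 * p ≤ (512 * C) ^ 2 * p * (D : ℝ) ^ 2 := by
      have : 144 * C ≤ (512 * C) ^ 2 := by nlinarith
      calc _ = 144 * C * (p * (D : ℝ) ^ 2) := by ring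
        _ ≤ (512 * C) ^ 2 * (p * (D : ℝ) ^ 2) := by gcongr
        _ = _ := by ring
    linarith
  have e2 : 16 * C * D ^ 2 * (4 * T * M ^ 2) ≤ H * M ^ 2 / 3 := by
    have := mul_le_mul_of_nonneg_right hTle (by positivity : (0 : ℝ) ≤ (M : ℝ) ^ 2)
    linarith
  have e3 : 16 * C * D ^ 2 * (8 * M * p / T) ≤ H * M ^ 2 / 3 := by
    rw [mul_div_assoc', div_le_iff₀ (by linarith)]
    have := mul_le_mul_of_nonneg_right hthird (by positivity : (0 : ℝ) ≤ (M : ℝ))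
    linarith
  calc 16 * C * D * (p * E) ≤
      16 * C * D * (D * M ^ 2 * (3 * p + 4 * T * M ^ 2 + 8 * M * p / T)) := by gcongr
    _ = M ^ 2 * (16 * C * D ^ 2 * (3 * p) + 16 * C * D ^ 2 * (4 * T * M ^ 2) +
          16 * C * D ^ 2 * (8 * M * p / T)) := by ring
    _ ≤ M ^ 2 * (H * M ^ 2 / 3 + H * M ^ 2 / 3 + H * M ^ 2 / 3) := by gcongr
    _ = _ := by ring

/-- The terms in p are at most H²M by `hyp1`, and the term in DNM is too because H ≥ 512D. -/
lemma sum_fejer_variance_le_of_large {p : ℕ} [Fact p.Prime] {D H M N : ℕ} {C : ℝ} {y : ZMod p}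
    (hD1 : 1 ≤ D) (hD : ∀ n : ℕ, n ≠ 0 → n ≤ p ^ 6 → #n.divisors ≤ D) (hHp : 8 * H ≤ p)
    (hMp : M ≤ p) (hH1 : 1 ≤ H) (hM1 : 1 ≤ M) (hC1 : 1 ≤ C)
    (hyne : ∀ t < M, y + (t : ℕ) ≠ 0) (hHD : 512 * C * D ^ 2 ≤ H)
    (hyp1 : (512 * C) ^ 2 * p * D ^ 4 ≤ (H : ℝ) ^ 2 * M)
    (hNH : N = 2 * H) :
    8 * (∑ a, ((∑ j ∈ range M,
      ‖expSum (range N) (fun t : ℕ => (t : ZMod p)) (a * (y + (j : ℕ))⁻¹)‖ ^ 2) - N * M) ^ 2) ≤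
      H * M ^ 2 * N ^ 4 := by
  have hpr : (0 : ℝ) < p := by exact_mod_cast (Fact.out : p.Prime).pos
  have hDr : (1 : ℝ) ≤ D := by exact_mod_cast hD1
  have hHr : (1 : ℝ) ≤ H := by exact_mod_cast hH1
  have hMr : (1 : ℝ) ≤ M := by exact_mod_cast hM1
  have hC0 : 0 < C := by linarith
  have hNr : (N : ℝ) = 2 * H := by rw [hNH]; push_cast; ring
  have h := sum_fejer_variance_le hD hMp (by omega : 4 * N ≤ p) (by omega) y hyne
  have h512 : 512 * (D : ℝ) ≤ H := by
    refine le_trans ?_ hHD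
    nlinarith [mul_le_mul hC1 hDr zero_le_one hC0.le]
  have e1 : 80 * D * p ≤ (H : ℝ) ^ 2 * M := by
    refine le_trans ?_ hyp1
    have h4 : (D : ℝ) ≤ D ^ 4 := by
      calc (D : ℝ) = D ^ 1 := (pow_one _).symm
        _ ≤ D ^ 4 := pow_le_pow_right₀ hDr (by norm_num)
    have : (80 : ℝ) ≤ (512 * C) ^ 2 := by nlinarith
    calc 80 * (D : ℝ) * p ≤ (512 * C) ^ 2 * D ^ 4 * p := by gcongr
      _ = _ := by ring
  have e2 : 512 * D * H * M ≤ (H : ℝ) ^ 2 * M := by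
    calc 512 * (D : ℝ) * H * M ≤ H * H * M := by gcongr
      _ = _ := by ring
  calc _ ≤ 8 * ((p : ℝ) * (N ^ 2 * (2 * N * M + 8 * D * N * M * (4 * N * M / p + 1)))) := by gcongr
    _ = (N : ℝ) ^ 3 * M * (16 * p + 64 * D * p + 256 * D * N * M) := by field_simp; ring
    _ ≤ (N : ℝ) ^ 3 * M * (2 * ((H : ℝ) ^ 2 * M)) := by
        gcongr
        rw [hNr]
        have : (p : ℝ) ≤ D * p := by nlinarith
        linarith
    _ = _ := by rw [hNr]; ring

/-- Each of the three summands is at most a quarter of the right-hand side, which leaves strict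
room. -/
lemma kernel_bound_lt {C D H M N Q₂ Q₄ : ℝ} (hC1 : 1 ≤ C) (hDr : 1 ≤ D) (hHr : 1 ≤ H)
    (hMr : 1 ≤ M) (hNr : N = 2 * H) (hQ40 : 0 ≤ Q₄) (hQ4 : 16 * C * D * Q₄ ≤ H * M ^ 4)
    (hQ2 : 8 * Q₂ ≤ H * M ^ 2 * N ^ 4) :
    6 * N ^ 2 * M ^ 2 * H ^ 2 * Q₄ + 2 * H * M ^ 4 * Q₂ + 4 * H * M ^ 2 * N ^ 4 * (C * D) * Q₄ <
      M ^ 2 * H ^ 2 * (N ^ 4 * M ^ 4) := by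
  have hNpos : 0 < N := by linarith
  have t1 : 24 * Q₄ ≤ N ^ 2 * M ^ 4 := by
    have hCD : 1 ≤ C * D := by nlinarith
    have h1 : 16 * Q₄ ≤ 16 * C * D * Q₄ := by
      have : 0 ≤ (C * D - 1) * Q₄ := mul_nonneg (by linarith) hQ40
      linarith
    have h2 : H * M ^ 4 ≤ H ^ 2 * M ^ 4 := by gcongr; nlinarith
    have h3 : 0 ≤ H ^ 2 * M ^ 4 := by positivity
    rw [hNr]
    linarith
  have b1 := mul_le_mul_of_nonneg_left t1 (by positivity : 0 ≤ N ^ 2 * M ^ 2 * H ^ 2)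
  have b2 := mul_le_mul_of_nonneg_left hQ2 (by positivity : 0 ≤ H * M ^ 4)
  have b3 := mul_le_mul_of_nonneg_left hQ4 (by positivity : 0 ≤ H * M ^ 2 * N ^ 4)
  have hpos : 0 < M ^ 2 * H ^ 2 * (N ^ 4 * M ^ 4) := by positivity
  linarith

/-! ### From the average to representations. -/

/-- If the nontrivial frequencies of a suitable four-term sumset are small, every residue class
is a sum of eight fractions. -/
lemma isSumOfFractions_of_sum_lt {p : ℕ} [Fact p.Prime] {M N : ℕ} {I J : Finset (ZMod p)}
    {c y x : ZMod p} {j₁ j₂ : ℕ} (hI : ∀ t < N, c + (t : ℕ) ∈ I)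
    (hJ : ∀ t < M, y + (t : ℕ) ∈ J ∧ y + (t : ℕ) ≠ 0) (hxmem : x ∈ I) (hj₁ : j₁ < M)
    (hj₂ : j₂ < M)
    (hlt : ∑ a ∈ univ.erase 0,
      ‖expSum (range N) (fun t : ℕ => (t : ZMod p)) (a * (y + (j₁ : ℕ))⁻¹)‖ ^ 2 *
      ‖expSum (range N) (fun t : ℕ => (t : ZMod p)) (a * (y + (j₂ : ℕ))⁻¹)‖ ^ 2 *
      ‖expSum (range M ×ˢ range M)
        (fun t : ℕ × ℕ => (y + (t.1 : ℕ))⁻¹ + (y + (t.2 : ℕ))⁻¹) (a * x)‖ ^ 2 <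
      (N : ℝ) ^ 4 * M ^ 4) (lam : ZMod p) :
    IsSumOfFractions p 8 I J lam := by
  set dirichlet : ZMod p → ℂ := expSum (range N) (fun t : ℕ => (t : ZMod p)) with hdir
  set recip : ℕ × ℕ → ZMod p := fun t => (y + (t.1 : ℕ))⁻¹ + (y + (t.2 : ℕ))⁻¹ with hrecip
  set P := range M ×ˢ range M with hP
  have hcP : #P = M ^ 2 := by rw [hP, card_product, card_range, sq]
  let g : (ℕ × ℕ) × (ℕ × ℕ) → ZMod p := fun r =>
    (c * (y + (j₁ : ℕ))⁻¹ + c * (y + (j₂ : ℕ))⁻¹) +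
      (((r.1.1 : ℕ) * (y + (j₁ : ℕ))⁻¹ + (r.1.2 : ℕ) * (y + (j₂ : ℕ))⁻¹) + recip r.2 * x)
  have hnorm : ∀ a, ‖expSum ((range N ×ˢ range N) ×ˢ P) g a‖ ^ 2 =
      ‖dirichlet (a * (y + (j₁ : ℕ))⁻¹)‖ ^ 2 * ‖dirichlet (a * (y + (j₂ : ℕ))⁻¹)‖ ^ 2 *
        ‖expSum P recip (a * x)‖ ^ 2 := by
    intro a
    rw [norm_expSum_const_add,
      expSum_product (range N ×ˢ range N) P
        (fun r : ℕ × ℕ =>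
          ((r.1 : ℕ) : ZMod p) * (y + (j₁ : ℕ))⁻¹ + ((r.2 : ℕ) : ZMod p) * (y + (j₂ : ℕ))⁻¹)
        (fun r => recip r * x),
      expSum_product (range N) (range N) (fun t : ℕ => (t : ZMod p) * (y + (j₁ : ℕ))⁻¹)
        (fun t : ℕ => (t : ZMod p) * (y + (j₂ : ℕ))⁻¹), expSum_mul_right, expSum_mul_right,
      expSum_mul_right, norm_mul, norm_mul, mul_pow, mul_pow]
  have hcard : ((#((range N ×ˢ range N) ×ˢ P) : ℕ) : ℝ) ^ 2 = (N : ℝ) ^ 4 * M ^ 4 := by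
    rw [card_product, card_product, card_range, hcP]; push_cast; ring
  have himage := card_image_gt_of_sum_lt ((range N ×ˢ range N) ×ˢ P) g (by
    rw [hcard]
    simpa only [hnorm] using hlt)
  obtain ⟨z, hz, z', hz', hzz⟩ := exists_add_eq_of_card_gt himage lam
  obtain ⟨r, hr, rfl⟩ := mem_image.1 hz
  obtain ⟨r', hr', rfl⟩ := mem_image.1 hz'
  simp only [hP, mem_product, mem_range] at hr hr'
  refine ⟨![c + (r.1.1 : ℕ), c + (r.1.2 : ℕ), x, x, c + (r'.1.1 : ℕ), c + (r'.1.2 : ℕ), x, x],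
    ![y + (j₁ : ℕ), y + (j₂ : ℕ), y + (r.2.1 : ℕ), y + (r.2.2 : ℕ),
      y + (j₁ : ℕ), y + (j₂ : ℕ), y + (r'.2.1 : ℕ), y + (r'.2.2 : ℕ)], ?_, ?_, ?_⟩
  · intro i
    fin_cases i
    · exact hI _ hr.1.1
    · exact hI _ hr.1.2
    · exact hxmem
    · exact hxmem
    · exact hI _ hr'.1.1
    · exact hI _ hr'.1.2
    · exact hxmem
    · exact hxmem
  · intro i
    fin_cases i
    · exact hJ _ hj₁
    · exact hJ _ hj₂
    · exact hJ _ hr.2.1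
    · exact hJ _ hr.2.2
    · exact hJ _ hj₁
    · exact hJ _ hj₂
    · exact hJ _ hr'.2.1
    · exact hJ _ hr'.2.2
  · rw [← hzz, Fin.sum_univ_eight]
    simp only [g, hrecip, div_eq_mul_inv]
    change (c + (r.1.1 : ℕ)) * (y + (j₁ : ℕ))⁻¹ + (c + (r.1.2 : ℕ)) * (y + (j₂ : ℕ))⁻¹ +
      x * (y + (r.2.1 : ℕ))⁻¹ + x * (y + (r.2.2 : ℕ))⁻¹ +
      (c + (r'.1.1 : ℕ)) * (y + (j₁ : ℕ))⁻¹ + (c + (r'.1.2 : ℕ)) * (y + (j₂ : ℕ))⁻¹ +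
      x * (y + (r'.2.1 : ℕ))⁻¹ + x * (y + (r'.2.2 : ℕ))⁻¹ = _
    ring

/-- The core result for boxes, with explicit dependence on a bound `D` for the divisor function. -/
lemma exists_isSumOfFractions_of_boxes :
    ∃ C : ℝ, 1 ≤ C ∧ ∀ (p : ℕ) [Fact p.Prime] (D H M : ℕ) (I J : Finset (ZMod p)) (c y : ZMod p),
      1 ≤ D → (∀ n : ℕ, n ≠ 0 → n ≤ p ^ 6 → #n.divisors ≤ D) → 8 * H ≤ p → M ≤ p →
      1 ≤ H → 1 ≤ M →
      (∀ t < 2 * H, c + (t : ℕ) ∈ I ∧ c + (t : ℕ) ≠ 0) →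
      (∀ t < M, y + (t : ℕ) ∈ J ∧ y + (t : ℕ) ≠ 0) →
      C * p * D ^ 4 ≤ (H : ℝ) ^ 2 * M → C * p * D ^ 2 ≤ (H : ℝ) * M ^ 2 →
      ∀ lam : ZMod p, IsSumOfFractions p 8 I J lam := by
  obtain ⟨C, hC1, hC⟩ := exists_sum_norm_expSum_div_le
  refine ⟨(512 * C) ^ 2, by nlinarith, ?_⟩
  intro p _ D H M I J c y hD1 hD hHp hMp hH1 hM1 hI hJ hyp1 hyp2 lam
  have hpr : (0 : ℝ) < p := by exact_mod_cast (Fact.out : p.Prime).pos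
  have hDr : (1 : ℝ) ≤ D := by exact_mod_cast hD1
  have hHr : (1 : ℝ) ≤ H := by exact_mod_cast hH1
  have hMr : (1 : ℝ) ≤ M := by exact_mod_cast hM1
  have hMpr : (M : ℝ) ≤ p := by exact_mod_cast hMp
  have hC0 : 0 < C := by linarith
  set N := 2 * H with hN
  have hNr : (N : ℝ) = 2 * H := by rw [hN]; push_cast; ring
  have hyne : ∀ t < M, y + (t : ℕ) ≠ 0 := fun t ht => (hJ t ht).2
  -- H + q₁ - q₂ stays between 1 and 2H - 1, so every averaged numerator lies in the box. This is
  -- why the box has length 2H.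
  have hxI : ∀ q ∈ range H ×ˢ range H, (c + H) + (q.1 : ℕ) - (q.2 : ℕ) ∈ I ∧
      (c + H) + (q.1 : ℕ) - (q.2 : ℕ) ≠ 0 := by
    intro q hq
    rw [mem_product, mem_range, mem_range] at hq
    have : (c + H) + (q.1 : ℕ) - (q.2 : ℕ) = c + ((H + q.1 - q.2 : ℕ) : ZMod p) := by
      rw [Nat.cast_sub (by omega)]; push_cast; ring
    rw [this]
    exact hI _ (by omega)
  have hHD : 512 * C * D ^ 2 ≤ H := by
    -- Since M ≤ p, `hyp1` alone forces `H` to dominate D².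
    have h1 : (512 * C * D ^ 2) ^ 2 * p ≤ (H : ℝ) ^ 2 * p := by
      calc (512 * C * (D : ℝ) ^ 2) ^ 2 * p = (512 * C) ^ 2 * p * D ^ 4 := by ring
        _ ≤ (H : ℝ) ^ 2 * M := hyp1
        _ ≤ _ := by gcongr
    exact (pow_le_pow_iff_left₀ (by positivity) (by positivity) two_ne_zero).1
      (le_of_mul_le_mul_right h1 hpr)
  have hQ4 := sum_reciprocal_moment_le hD1 hD hHp hMp hH1 hM1 hC1 hyne hHD hyp1 hyp2
  have hQ2 := sum_fejer_variance_le_of_large hD1 hD hHp hMp hH1 hM1 hC1 hyne hHD hyp1 hN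
  set P := range M ×ˢ range M with hP
  have hcP : #P = M ^ 2 := by rw [hP, card_product, card_range, sq]
  set recip : ℕ × ℕ → ZMod p := fun t => (y + (t.1 : ℕ))⁻¹ + (y + (t.2 : ℕ))⁻¹ with hrecip
  have hsum := sum_kernel_le (p := p) (H := H) (N := N) (M := M)
    (d := fun b => ‖expSum (range N) (fun t : ℕ => (t : ZMod p)) b‖ ^ 2)
    (k := fun b => ‖expSum P recip b‖ ^ 2)
    (Y := fun j => y + (j : ℕ)) (c := c + H) (Λ := C * D) (by omega) (fun _ => by positivity)
    (fun b => by
      have := norm_expSum_le (range N) (fun t : ℕ => (t : ZMod p)) b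
      rw [card_range] at this
      exact pow_le_pow_left₀ (norm_nonneg _) this 2)
    (fun _ => by positivity) (fun b => by rw [norm_expSum_neg])
    (by rw [expSum_zero_right, hcP, Complex.norm_natCast]; push_cast; ring) hyne
    (fun q hq => (hxI q hq).2) (fun a => sum_norm_expSum_shift_le P recip H (c + H) a)
    (fun a ha => hC p D H N hD (by omega) (by omega) a ha)
  have htotal := kernel_bound_lt hC1 hDr hHr hMr hNr
    (sum_nonneg fun a _ => sq_nonneg ‖expSum P recip a‖) hQ4 hQ2
  have hconst : (M : ℝ) ^ 2 * H ^ 2 * (N ^ 4 * M ^ 4) =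
      ∑ _r ∈ (range M ×ˢ range M) ×ˢ (range H ×ˢ range H), ((N : ℝ) ^ 4 * M ^ 4) := by
    rw [sum_const, nsmul_eq_mul]
    simp only [card_product, card_range]
    push_cast; ring
  -- Some choice of two denominators and a numerator does no worse than the average.
  obtain ⟨⟨⟨j₁, j₂⟩, q⟩, hr, hlt⟩ := exists_lt_of_sum_lt ((hsum.trans_lt htotal).trans_eq hconst)
  obtain ⟨hj, hq⟩ := mem_product.1 hr
  obtain ⟨hj₁, hj₂⟩ := mem_product.1 hj
  exact isSumOfFractions_of_sum_lt (fun t ht => (hI t ht).1) hJ (hxI q hq).1 (mem_range.1 hj₁)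
    (mem_range.1 hj₂) hlt lam

/-! ### Intervals and the choice of parameters. -/

/-- An interval of `ZMod p` contains an interval of half its length that avoids zero. -/
lemma IsIntervalMod.exists_subinterval {p : ℕ} [Fact p.Prime] {I : Finset (ZMod p)}
    (hI : IsIntervalMod p I) {L : ℕ} (hL : 2 * L ≤ #I) :
    ∃ c : ZMod p, ∀ t < L, c + (t : ℕ) ∈ I ∧ c + (t : ℕ) ≠ 0 := by
  obtain ⟨m, n, rfl⟩ := hI
  have h1 : 2 * L ≤ (n + 1 - m).toNat := hL.trans (card_image_le.trans (Int.card_Icc m n).le)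
  have h2 : 2 * L ≤ p := hL.trans ((card_le_univ _).trans (ZMod.card p).le)
  have hmem : ∀ t : ℕ, t < 2 * L →
      ((m : ZMod p) + (t : ℕ)) ∈ (Icc m n).image fun k : ℤ => (k : ZMod p) := by
    intro t ht
    refine mem_image.2 ⟨m + t, mem_Icc.2 ⟨by omega, by omega⟩, by push_cast; rfl⟩
  -- Among 2L ≤ p consecutive classes zero occurs at most once, so one of the two halves avoids it.
  by_cases h : ∀ t < L, (m : ZMod p) + (t : ℕ) ≠ 0
  · exact ⟨m, fun t ht => ⟨hmem t (by omega), h t ht⟩⟩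
  push Not at h
  obtain ⟨t, ht, hz⟩ := h
  refine ⟨m + (L : ℕ), fun t' ht' => ⟨?_, fun hz' => ?_⟩⟩
  · have := hmem (L + t') (by omega)
    push_cast at this
    rwa [add_assoc]
  · have e : ((L + t' - t : ℕ) : ZMod p) = 0 := by
      rw [Nat.cast_sub (by omega)]; push_cast
      linear_combination hz' - hz
    rw [ZMod.natCast_eq_zero_iff] at e
    have := Nat.le_of_dvd (by omega) e
    omega

lemma exists_isSumOfFractions_of_card {ε : ℝ} (hε : 0 < ε) :
    ∃ p₀ : ℕ, ∀ (p : ℕ) [Fact p.Prime], p₀ ≤ p →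
      ∀ I J : Finset (ZMod p), IsIntervalMod p I → IsIntervalMod p J →
        (p : ℝ) ^ (1 + ε) < (#I : ℝ) ^ 2 * (#J : ℝ) →
        (p : ℝ) ^ (1 + ε) < (#I : ℝ) * (#J : ℝ) ^ 2 →
        ∀ lam : ZMod p, IsSumOfFractions p 8 I J lam := by
  obtain ⟨C, hC1, hcore⟩ := exists_isSumOfFractions_of_boxes
  -- With η = ε/8 the loss D⁴ is at most X = p^{ε/2}. The other factor X of p^ε pays for `C` and for
  -- 1024 = 16²·4, the cost of passing to H ≥ #I/16 and M ≥ #J/4.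
  obtain ⟨p₁, hp₁⟩ := exists_divisor_bound (η := ε / 8) (by positivity)
  have ht : Filter.Tendsto (fun p : ℕ => (p : ℝ) ^ (ε / 2)) Filter.atTop Filter.atTop :=
    (tendsto_rpow_atTop (by positivity)).comp tendsto_natCast_atTop_atTop
  obtain ⟨p₂, hp₂⟩ := Filter.eventually_atTop.1 (ht.eventually_ge_atTop (1024 * C))
  refine ⟨max p₁ p₂, fun p _ hp I J hI hJ h1 h2 lam => ?_⟩
  obtain ⟨D, hD1, hDle, hD⟩ := hp₁ p ((le_max_left _ _).trans hp)
  have hpC := hp₂ p ((le_max_right _ _).trans hp)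
  have hp0 : (0 : ℝ) < p := by exact_mod_cast (Fact.out : p.Prime).pos
  have hDr : (1 : ℝ) ≤ D := by exact_mod_cast hD1
  have hIp : #I ≤ p := (card_le_univ _).trans (ZMod.card p).le
  have hJp : #J ≤ p := (card_le_univ _).trans (ZMod.card p).le
  have hIpr : (#I : ℝ) ≤ p := by exact_mod_cast hIp
  have hJpr : (#J : ℝ) ≤ p := by exact_mod_cast hJp
  set X := (p : ℝ) ^ (ε / 2) with hX
  have hX0 : 1024 ≤ X := by linarith
  have hpow : (p : ℝ) ^ (1 + ε) = p * (X * X) := by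
    rw [hX, ← Real.rpow_add hp0, Real.rpow_add hp0, Real.rpow_one, add_halves]
  have hD4 : (D : ℝ) ^ 4 ≤ X := by
    calc (D : ℝ) ^ 4 ≤ ((p : ℝ) ^ (ε / 8)) ^ 4 := by gcongr
      _ = X := by
        rw [hX, ← Real.rpow_natCast, ← Real.rpow_mul hp0.le]; congr 1; push_cast; ring
  have hI8 : 8 ≤ #I := by
    have h3 : p * (X * X) < (#I : ℝ) ^ 2 * p := by
      rw [← hpow]; exact h1.trans_le (by gcongr)
    have h4 : X * X < (#I : ℝ) ^ 2 := by
      rw [mul_comm] at h3; exact lt_of_mul_lt_mul_right h3 hp0.le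
    have h5 : (8 : ℝ) < #I := by nlinarith
    exact_mod_cast h5.le
  have hJ2 : 2 ≤ #J := by
    have h3 : p * (X * X) < p * (#J : ℝ) ^ 2 := by
      rw [← hpow]; exact h2.trans_le (by gcongr)
    have h4 : X * X < (#J : ℝ) ^ 2 := lt_of_mul_lt_mul_left h3 hp0.le
    have h5 : (2 : ℝ) < #J := by nlinarith
    exact_mod_cast h5.le
  obtain ⟨c, hc⟩ := hI.exists_subinterval (L := 2 * (#I / 8)) (by omega)
  obtain ⟨y, hy⟩ := hJ.exists_subinterval (L := #J / 2) (by omega)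
  have hH : (#I : ℝ) / 16 ≤ (#I / 8 : ℕ) := by
    have : #I ≤ 16 * (#I / 8) := by omega
    have : (#I : ℝ) ≤ 16 * (#I / 8 : ℕ) := by exact_mod_cast this
    linarith
  have hM : (#J : ℝ) / 4 ≤ (#J / 2 : ℕ) := by
    have : #J ≤ 4 * (#J / 2) := by omega
    have : (#J : ℝ) ≤ 4 * (#J / 2 : ℕ) := by exact_mod_cast this
    linarith
  have hCX : ∀ A : ℝ, A ≤ X → C * p * A ≤ p * (X * X) / 1024 := by
    intro A hA
    calc C * p * A ≤ C * p * X := by gcongr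
      _ ≤ (X / 1024) * p * X := by gcongr; linarith
      _ = _ := by ring
  refine hcore p D (#I / 8) (#J / 2) I J c y hD1 hD (by omega) (by omega) (by omega) (by omega)
    hc hy ?_ ?_ lam
  · calc C * p * (D : ℝ) ^ 4 ≤ p * (X * X) / 1024 := hCX _ hD4
      _ ≤ (#I : ℝ) ^ 2 * #J / 1024 := by rw [← hpow]; gcongr
      _ = ((#I : ℝ) / 16) ^ 2 * (#J / 4) := by ring
      _ ≤ _ := by gcongr
  · calc C * p * (D : ℝ) ^ 2 ≤ p * (X * X) / 1024 :=
          hCX _ ((pow_le_pow_right₀ hDr (by norm_num)).trans hD4)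
      _ ≤ (#I : ℝ) * #J ^ 2 / 1024 := by rw [← hpow]; gcongr
      _ ≤ ((#I : ℝ) / 16) * (#J / 4) ^ 2 := by
          have : (0 : ℝ) ≤ #I * (#J : ℝ) ^ 2 := by positivity
          linarith
      _ ≤ _ := by gcongr

end FractionSums

theorem theorem1 (ε : ℝ) (hε : 0 < ε) :
    (∃ p₀ : ℕ, ∀ (p : ℕ) [Fact p.Prime], p₀ ≤ p →
      ∀ I J : Finset (ZMod p), IsIntervalMod p I → IsIntervalMod p J →
        (p : ℝ) ^ (1 + ε) < (I.card : ℝ) ^ 2 * (J.card : ℝ) →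
        (p : ℝ) ^ (1 + ε) < (I.card : ℝ) * (J.card : ℝ) ^ 2 →
        ∀ lam : ZMod p, IsSumOfFractions p 8 I J lam) ∧
    (∃ δ : ℝ, 0 < δ ∧ ∃ p₀ : ℕ, ∀ (p : ℕ) [Fact p.Prime], p₀ ≤ p →
      ∀ I J : Finset (ZMod p), IsIntervalMod p I → IsIntervalMod p J →
        (p : ℝ) ^ (1 / 3 + ε) < (I.card : ℝ) →
        (p : ℝ) ^ (1 / 3 - δ) < (J.card : ℝ) →
        ∀ lam : ZMod p, IsSumOfFractions p 8 I J lam) := by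
  -- The first part is applied with ε/2. For δ = ε/4 the exponents are 2(1/3 + ε) + (1/3 - δ) = 1 +
  -- 7ε/4 and (1/3 + ε) + 2(1/3 - δ) = 1 + ε/2, the second with equality.
  refine ⟨exists_isSumOfFractions_of_card hε, ε / 4, by positivity, ?_⟩
  obtain ⟨p₀, hp₀⟩ := exists_isSumOfFractions_of_card (half_pos hε)
  refine ⟨p₀, fun p _ hp I J hI hJ h1 h2 lam => hp₀ p hp I J hI hJ ?_ ?_ lam⟩
  all_goals
    have hp1 : (1 : ℝ) ≤ p := by exact_mod_cast (Fact.out : p.Prime).one_lt.le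
    have hp0 : (0 : ℝ) < p := by linarith
  · calc (p : ℝ) ^ (1 + ε / 2)
        ≤ (p : ℝ) ^ ((1 / 3 + ε) * (2 : ℕ) + (1 / 3 - ε / 4)) :=
          Real.rpow_le_rpow_of_exponent_le hp1 (by push_cast; linarith)
      _ = ((p : ℝ) ^ (1 / 3 + ε)) ^ 2 * (p : ℝ) ^ (1 / 3 - ε / 4) := by
          rw [Real.rpow_add hp0, Real.rpow_mul_natCast hp0.le]
      _ < _ := by gcongr
  · calc (p : ℝ) ^ (1 + ε / 2)
        ≤ (p : ℝ) ^ ((1 / 3 + ε) + (1 / 3 - ε / 4) * (2 : ℕ)) :=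
          Real.rpow_le_rpow_of_exponent_le hp1 (by push_cast; linarith)
      _ = (p : ℝ) ^ (1 / 3 + ε) * ((p : ℝ) ^ (1 / 3 - ε / 4)) ^ 2 := by
          rw [Real.rpow_add hp0, Real.rpow_mul_natCast hp0.le]
      _ < _ := by gcongr
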